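/- Let $n\ge 0$, let $G$ be an abelian subgroup of $GL(n,\mathbb{C})$ and $u\in\mathbb{C}^n$. Notation. For $v\in\mathbb{C}^n$ let $G(v)=\{Av: A\in G\}$ be its orbit, $E(v)$ the complex vector subspace spanned by $G(v)$, and $r(v)=\dim_{\mathbb{C}}E(v)$. An orbit $\gamma$ is *regular with order $m$* if every $v\in\gamma$ has an open neighbourhood $O$ in $\mathbb{C}^n$ such that $\overline{\gamma}\cap O$ is a (smooth, embedded) submanifold of $\mathbb{C}^n$ of dimension $m$ over $\mathbb{R}$. For a closed additive subgroup $F$ of $\mathbb{C}^n$, $\dim F$ is the largest dimension of a real vector subspace contained in $F$. Let $\mathbb{T}_k(\mathbb{C})$ be the set of lower triangular $k\times k$ complex matrices with all diagonal entries equal and, for $\eta=(n_1,\dots,n_r)$ with all $n_i\ge 1$ and $\sum_i n_i=n$, let $\mathcal{K}_{\eta,r}(\mathbb{C})=\mathbb{T}_{n_1}(\mathbb{C})\oplus\dots\oplus\mathbb{T}_{n_r}(\mathbb{C})$ (block diagonal matrices) and $\mathcal{K}^*_{\eta,r}(\mathbb{C})=\mathcal{K}_{\eta,r}(\mathbb{C})\cap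 GL(n,\mathbb{C})$. There exists a $G$-invariant, dense, relatively open subset $U_u$ of $E(u)$ with $u\in U_u$, such that $E(v)=E(u)$ for all $v\in U_u$, any two orbits in $U_u$ are isomorphic (one is the image of the other under an invertible linear map), and $E(u)\setminus U_u$ is a union of at most $r(u)$ $G$-invariant complex vector subspaces of dimension $r(u)-1$. There also exist $P\in GL(n,\mathbb{C})$ and $r,\eta$ as above with $P^{-1}GP\subset\mathcal{K}^*_{\eta,r}(\mathbb{C})$. For every such $U_u$, every such $P,r,\eta$, and every integer $m\ge 0$, put $\mathrm{g}=\exp^{-1}(G)\cap P\,\mathcal{K}_{\eta,r}(\mathbb{C})\,P^{-1}$ and $\mathrm{g}_u=\{Bu: B\in\mathrm{g}\}$, an additive subgroup of $\mathbb{C}^n$. Then the following are equivalent: (i) $G(u)$ is regular with order $m$; (ii) for every $v\in U_u$, $G(v)$ is regular with order $m$; (iii) $\dim\overline{\mathrm{g}_u}=m$ over $\mathbb{R}$. -/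

import Mathlib

open Set Topology
open scoped Matrix ContDiff

namespace AbelianLinear

/-! ### Smooth submanifolds and the dimension of a closed additive subgroup -/

/-- `S` is a (smooth, embedded) submanifold of dimension `m` over `ℝ` of the real normed space `E`:
around each of its points there is a smooth diffeomorphism between open subsets of `E` which
carries `S` to an `m`-dimensional real vector subspace. -/
def IsSubmanifold {E : Type*} [NormedAddCommGroup E] [NormedSpace ℝ E] (m : ℕ) (S : Set E) :
    Prop :=
  ∀ x ∈ S, ∃ (e : OpenPartialHomeomorph E E) (V : Submodule ℝ E),
    x ∈ e.source ∧ ContDiffOn ℝ ∞ e e.source ∧ ContDiffOn ℝ ∞ e.symm e.target ∧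
      Module.finrank ℝ V = m ∧ e '' (e.source ∩ S) = e.target ∩ (V : Set E)

/-- The dimension over `ℝ` of a closed additive subgroup `F` is `m`: this is the largest dimension
of a real vector subspace contained in `F`. -/
def HasRealDim {E : Type*} [AddCommGroup E] [Module ℝ E] (F : Set E) (m : ℕ) : Prop :=
  IsGreatest {d : ℕ | ∃ V : Submodule ℝ E, (V : Set E) ⊆ F ∧ Module.finrank ℝ V = d} m

/-! ### Orbits of a linear group -/

variable {n : ℕ}

/-- The orbit `G(u)`. -/
def orbit (G : Subgroup (GL (Fin n) ℂ)) (u : Fin n → ℂ) : Set (Fin n → ℂ) :=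
  {v | ∃ A ∈ G, (A : Matrix (Fin n) (Fin n) ℂ) *ᵥ u = v}

/-- `E(u)`, the complex vector subspace generated by the orbit `G(u)`. -/
def orbitSpan (G : Subgroup (GL (Fin n) ℂ)) (u : Fin n → ℂ) : Submodule ℂ (Fin n → ℂ) :=
  Submodule.span ℂ (orbit G u)

/-- `r(u)`, the complex dimension of `E(u)`. -/
noncomputable def orbitRank (G : Subgroup (GL (Fin n) ℂ)) (u : Fin n → ℂ) : ℕ :=
  Module.finrank ℂ (orbitSpan G u)

/-- A set is `G`-invariant if every element of `G` maps it into itself. -/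
def IsInvariantSet (G : Subgroup (GL (Fin n) ℂ)) (S : Set (Fin n → ℂ)) : Prop :=
  ∀ A ∈ G, ∀ v ∈ S, (A : Matrix (Fin n) (Fin n) ℂ) *ᵥ v ∈ S

/-- The set `γ` (an orbit) is regular with order `m`: each of its points has an open neighbourhood
`O` such that `closure γ ∩ O` is a manifold of dimension `m` over `ℝ`. -/
def IsRegularOfOrder (m : ℕ) (γ : Set (Fin n → ℂ)) : Prop :=
  ∀ v ∈ γ, ∃ O : Set (Fin n → ℂ), IsOpen O ∧ v ∈ O ∧ IsSubmanifold m (closure γ ∩ O)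

/-- `U` is the region `U_u` of `E(u)`: a `G`-invariant dense open subset of `E(u)` containing `u`,
all of whose points span the same space `E(u)`, all of whose orbits are isomorphic, and whose
complement in `E(u)` is a union of at most `r(u)` `G`-invariant vector subspaces of complex
dimension `r(u) - 1`. These conditions determine `U`: it is the complement in `E(u)` of the
union of all `G`-invariant subspaces of dimension `r(u) - 1`. -/
structure IsOrbitRegion (G : Subgroup (GL (Fin n) ℂ)) (u : Fin n → ℂ) (U : Set (Fin n → ℂ)) :
    Prop where
  invariant : IsInvariantSet G U
  mem : u ∈ U
  relOpen : ∃ O : Set (Fin n → ℂ), IsOpen O ∧ U = (orbitSpan G u : Set (Fin n → ℂ)) ∩ O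
  relDense : (orbitSpan G u : Set (Fin n → ℂ)) ⊆ closure U
  span_eq : ∀ v ∈ U, orbitSpan G v = orbitSpan G u
  isomorphic : ∀ v ∈ U, ∀ w ∈ U, ∃ T : (Fin n → ℂ) ≃ₗ[ℂ] (Fin n → ℂ),
    T '' orbit G v = orbit G w
  compl : ∃ s : Finset (Submodule ℂ (Fin n → ℂ)), s.card ≤ orbitRank G u ∧
    (∀ H ∈ s, H ≤ orbitSpan G u ∧ Module.finrank ℂ H + 1 = orbitRank G u ∧
      IsInvariantSet G (H : Set (Fin n → ℂ))) ∧
    (orbitSpan G u : Set (Fin n → ℂ)) \ U = ⋃ H ∈ s, (H : Set (Fin n → ℂ))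

/-! ### Normal forms and the exponential -/

/-- `𝕋_m(ℂ)`: lower triangular matrices with all diagonal entries equal. -/
def triangular (m : ℕ) : Set (Matrix (Fin m) (Fin m) ℂ) :=
  {T | (∃ μ : ℂ, ∀ i, T i i = μ) ∧ ∀ i j, i < j → T i j = 0}

/-- `𝒦_{η,r}(ℂ)`: block diagonal matrices whose consecutive diagonal blocks lie in
`𝕋_{n_1}(ℂ), …, 𝕋_{n_r}(ℂ)`; here `η = (n_1, …, n_r)` is a composition of `n`, that is, a list of
positive integers with sum `n`, and `r` is its length. -/
def blockTriangular (η : Composition n) : Set (Matrix (Fin n) (Fin n) ℂ) :=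
  {M | ∃ T : ∀ k : Fin η.length, Matrix (Fin (η.blocksFun k)) (Fin (η.blocksFun k)) ℂ,
    (∀ k, T k ∈ triangular (η.blocksFun k)) ∧
      M = Matrix.reindex η.blocksFinEquiv η.blocksFinEquiv (Matrix.blockDiagonal' T)}

/-- `P⁻¹GP` is a normal form of `G`, namely a subgroup of `𝒦*_{η,r}(ℂ)`. -/
def IsNormalForm (G : Subgroup (GL (Fin n) ℂ)) (P : GL (Fin n) ℂ) (η : Composition n) : Prop :=
  ∀ A ∈ G, ((P⁻¹ * A * P : GL (Fin n) ℂ) : Matrix (Fin n) (Fin n) ℂ) ∈ blockTriangular η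

/-- `g = exp⁻¹(G) ∩ P 𝒦_{η,r}(ℂ) P⁻¹`. -/
def logSet (G : Subgroup (GL (Fin n) ℂ)) (P : GL (Fin n) ℂ) (η : Composition n) :
    Set (Matrix (Fin n) (Fin n) ℂ) :=
  {B | (∃ A ∈ G, NormedSpace.exp B = (A : Matrix (Fin n) (Fin n) ℂ)) ∧
    ∃ M ∈ blockTriangular η, B = (P : Matrix (Fin n) (Fin n) ℂ) * M *
      ((P⁻¹ : GL (Fin n) ℂ) : Matrix (Fin n) (Fin n) ℂ)}

/-- `g_u = {B u : B ∈ g}`. -/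
def logOrbit (G : Subgroup (GL (Fin n) ℂ)) (P : GL (Fin n) ℂ) (η : Composition n)
    (u : Fin n → ℂ) : Set (Fin n → ℂ) :=
  {w | ∃ B ∈ logSet G P η, B *ᵥ u = w}

end AbelianLinear

namespace AbelianLinear

/-! ### The exponential of nilpotent matrices -/

section Exponential

open NormedSpace Polynomial
variable {n : ℕ}

/-! Every orbit of an abelian linear group turns out to be regular, of order the dimension of the
closure of `g_u`. Since the order of a regular orbit is unique (`IsSubmanifold.dim_le`), this gives
(i) ⇔ (iii); (i) ⇔ (ii) follows because orbits in `U_u` are linearly isomorphic.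

For regularity, let `𝒦` be the conjugated block triangular algebra and `𝒞` the commutative algebra
generated by `G` and the block scalars `δ μ`. Logarithms in `𝒦` of elements of `G` lie in `𝒞`
(`IsSplit.mem_of_exp_mem`), so `g_u` is an additive group. The map `C u ↦ exp(C) u` is well defined
on `𝒞 u`; `straighten` extends it to a smooth map with derivative the identity at `0`. It sends
`g_u` into `G(u)`. Conversely, whatever it sends into `G(u)` lies in `g_u`, because two logarithms
with the same effect on `u` differ on `u` by a period `δ μ` with `exp (δ μ) = 1`
(`IsSplit.exists_exp_eq_one`). Hence near `u` the closure of `G(u)` is diffeomorphic to the closure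
of `g_u` near `0`, where a closed subgroup is a vector space. Elements of `G` transport this to the
other points of the orbit.

For `U_u`, take the vectors that generate `E(u)`. A vector fails to do so exactly when a functional
given by a character of `G` kills it; independence of characters bounds the number of these by
`r(u)`. The normal form comes from joint generalized eigenspaces, triangularized by common
eigenfunctionals. -/

theorem exp_mem_subalgebra (𝒜 : Subalgebra ℂ (Matrix (Fin n) (Fin n) ℂ))
    {X : Matrix (Fin n) (Fin n) ℂ} (hX : X ∈ 𝒜) : exp X ∈ 𝒜 :=
  exp_mem (R := ℂ) (s := 𝒜) (Submodule.closed_of_finiteDimensional (Subalgebra.toSubmodule 𝒜)) hX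

/-- The terms of degree at least two in the exponential series lie in the space of all `(p ^ 2 *
q)(M)`, which is finite dimensional, hence closed, so it contains their sum. -/
theorem exists_exp_aeval (M : Matrix (Fin n) (Fin n) ℂ) (p : ℂ[X]) :
    ∃ s : ℂ[X], exp (aeval M p) = aeval M (1 + p + p ^ 2 * s) := by
  let S : Submodule ℂ (Matrix (Fin n) (Fin n) ℂ) :=
    LinearMap.range ((aeval M).toLinearMap ∘ₗ LinearMap.mulLeft ℂ (p ^ 2))
  have hS : IsClosed (S : Set (Matrix (Fin n) (Fin n) ℂ)) := S.closed_of_finiteDimensional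
  have h : HasSum (fun k => ((k.factorial : ℂ)⁻¹) • aeval M p ^ k) (exp (aeval M p)) := by
    open scoped Matrix.Norms.Operator in exact exp_series_hasSum_exp' (𝕂 := ℂ) (aeval M p)
  rw [← hasSum_nat_add_iff' 2] at h
  have hmem := hS.mem_of_tendsto h (Filter.Eventually.of_forall fun t => S.sum_mem fun k _ => by
    refine S.smul_mem _ ⟨p ^ k, ?_⟩
    simp [← pow_add, add_comm])
  obtain ⟨s, hs⟩ := hmem
  refine ⟨s, ?_⟩
  have hs' : aeval M (p ^ 2 * s) = exp (aeval M p) - _ := hs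
  rw [map_add, hs']
  simp [Finset.sum_range_succ]

/-- The factor `V = 1 + s(N) N` is unipotent, hence a unit. Thus `exp N - 1` and `N` have the same
kernel, which yields the next lemmas. -/
theorem exists_exp_eq_one_add {N : Matrix (Fin n) (Fin n) ℂ} (hN : IsNilpotent N) :
    ∃ V : Matrix (Fin n) (Fin n) ℂ, IsUnit V ∧ Commute N V ∧ exp N = 1 + V * N := by
  obtain ⟨s, hs⟩ := exists_exp_aeval N X
  have hc : Commute N (aeval N s) := by
    simpa using ((Commute.all X s).map (aeval N))
  refine ⟨1 + aeval N s * N, ?_, ?_, ?_⟩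
  · exact (hc.symm.isNilpotent_mul_left hN).isUnit_one_add
  · exact (Commute.one_right N).add_right (hc.mul_right (Commute.refl N))
  · have e : (1 + X + X ^ 2 * s : ℂ[X]) = 1 + (1 + s * X) * X := by ring
    rw [e] at hs
    simpa using hs

theorem isNilpotent_exp_sub_one {N : Matrix (Fin n) (Fin n) ℂ} (hN : IsNilpotent N) :
    IsNilpotent (exp N - 1) := by
  obtain ⟨V, -, hc, h⟩ := exists_exp_eq_one_add hN
  rw [h, add_sub_cancel_left]
  exact hc.symm.isNilpotent_mul_left hN

theorem mulVec_eq_zero_of_exp_mulVec_eq {N : Matrix (Fin n) (Fin n) ℂ} (hN : IsNilpotent N)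
    {v : Fin n → ℂ} (hv : exp N *ᵥ v = v) : N *ᵥ v = 0 := by
  obtain ⟨V, hV, -, h⟩ := exists_exp_eq_one_add hN
  rw [h, Matrix.add_mulVec, Matrix.one_mulVec, add_eq_left, ← Matrix.mulVec_mulVec] at hv
  exact (Matrix.mulVec_injective_of_isUnit hV) (by rw [hv, Matrix.mulVec_zero])

theorem eq_zero_of_exp_eq_one {N : Matrix (Fin n) (Fin n) ℂ} (hN : IsNilpotent N)
    (h1 : exp N = 1) : N = 0 := by
  obtain ⟨V, hV, -, h⟩ := exists_exp_eq_one_add hN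
  rw [h, add_eq_left] at h1
  exact hV.mul_right_eq_zero.1 h1

/-- A unipotent matrix `1 + M` has a nilpotent logarithm which is a polynomial in `M`. -/
theorem exists_log_one_add {M : Matrix (Fin n) (Fin n) ℂ} (hM : IsNilpotent M) :
    ∃ N ∈ Algebra.adjoin ℂ {M}, IsNilpotent N ∧ exp N = 1 + M := by
  -- Successive approximation: `p * X` is a logarithm up to an error factor `1 + O(X ^ (k + 1))`,
  -- which becomes `1` once `k` exceeds the nilpotency index.
  have key : ∀ k : ℕ, ∃ p r : ℂ[X],
      exp (aeval M (p * X)) * aeval M (1 + X ^ (k + 1) * r) = 1 + M := by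
    intro k
    induction k with
    | zero => exact ⟨0, 1, by simp⟩
    | succ k ih =>
      obtain ⟨p, r, h⟩ := ih
      obtain ⟨s, hs⟩ := exists_exp_aeval M (-(X ^ (k + 1) * r))
      -- With `Y = X ^ (k + 1) * r`, adding `Y` to the exponent turns the error `1 + Y` into
      -- `exp(-Y) (1 + Y) = 1 + Y² (-1 + (1 + Y) s)`.
      refine ⟨p + X ^ k * r, X ^ k * r ^ 2 * (-1 + (1 + X ^ (k + 1) * r) * s), ?_⟩
      rw [← h]
      have e1 : (p + X ^ k * r) * X = p * X + X ^ (k + 1) * r := by ring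
      have e2 : (1 + X ^ (k + 1 + 1) * (X ^ k * r ^ 2 * (-1 + (1 + X ^ (k + 1) * r) * s)) : ℂ[X])
          = (1 + -(X ^ (k + 1) * r) + (-(X ^ (k + 1) * r)) ^ 2 * s) *
            (1 + X ^ (k + 1) * r) := by ring
      have hc : Commute (aeval M (p * X)) (aeval M (X ^ (k + 1) * r)) :=
        (Commute.all (p * X) (X ^ (k + 1) * r)).map (aeval M)
      have hc' : exp (aeval M (X ^ (k + 1) * r)) * exp (-aeval M (X ^ (k + 1) * r)) = 1 := by
        rw [← Matrix.exp_add_of_commute _ _ (Commute.refl (aeval M (X ^ (k + 1) * r))).neg_right,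
          add_neg_cancel, exp_zero]
      rw [e1, e2, map_mul (aeval M) (_ + _) (_ + _), ← hs, map_neg, map_add _ (p * X),
        Matrix.exp_add_of_commute _ _ hc, mul_assoc,
        ← mul_assoc (exp (aeval M (X ^ (k + 1) * r))), hc', one_mul]
  obtain ⟨k, hk⟩ := hM
  obtain ⟨p, r, h⟩ := key k
  refine ⟨aeval M (p * X), Polynomial.aeval_mem_adjoin_singleton _ _, ?_, ?_⟩
  · rw [map_mul, aeval_X]
    have : Commute (aeval M p) M := by simpa using ((Commute.all p X).map (aeval M))
    exact this.isNilpotent_mul_left ⟨k, hk⟩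
  · rw [← h]
    simp [pow_succ, hk]

end Exponential

/-! ### Closed additive subgroups -/

section ClosedSubgroup

variable {E : Type*} [NormedAddCommGroup E] [NormedSpace ℝ E]

/-- The largest real vector subspace contained in a closed additive subgroup. -/
def maxSubspace (F : AddSubgroup E) : Submodule ℝ E where
  carrier := {v | ∀ t : ℝ, t • v ∈ F}
  add_mem' ha hb t := by rw [smul_add]; exact F.add_mem (ha t) (hb t)
  zero_mem' t := by rw [smul_zero]; exact F.zero_mem
  smul_mem' c v hv t := by rw [smul_smul]; exact hv _

theorem maxSubspace_le (F : AddSubgroup E) : (maxSubspace F : Set E) ⊆ F := fun v hv => by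
  simpa using hv 1

theorem le_maxSubspace {F : AddSubgroup E} {V : Submodule ℝ E} (h : (V : Set E) ⊆ F) :
    V ≤ maxSubspace F := fun _ hv t => h (V.smul_mem t hv)

theorem hasRealDim_iff [FiniteDimensional ℝ E] (F : AddSubgroup E) (m : ℕ) :
    HasRealDim (F : Set E) m ↔ m = Module.finrank ℝ (maxSubspace F) := by
  have h : HasRealDim (F : Set E) (Module.finrank ℝ (maxSubspace F)) := by
    refine ⟨⟨_, maxSubspace_le F, rfl⟩, ?_⟩
    rintro d ⟨V, hV, rfl⟩
    exact Submodule.finrank_mono (le_maxSubspace hV)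
  exact ⟨fun h' => h'.unique h, fun h' => h' ▸ h⟩

/-- The integer multiples `⌊t / ‖x k‖⌋ • x k` stay in `F` and converge to `t • y`, the rounding
error being at most `‖x k‖`. -/
theorem mem_maxSubspace_of_tendsto {F : AddSubgroup E} (hF : IsClosed (F : Set E)) {x : ℕ → E}
    (hx : ∀ k, x k ∈ F) (hx0 : Filter.Tendsto x Filter.atTop (𝓝 0)) {y : E}
    (hy : Filter.Tendsto (fun k => ‖x k‖⁻¹ • x k) Filter.atTop (𝓝 y)) : y ∈ maxSubspace F := by
  intro t
  have h1 : Filter.Tendsto (fun k => Int.fract (t * ‖x k‖⁻¹) • x k) Filter.atTop (𝓝 0) := by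
    refine squeeze_zero_norm (fun k => ?_) (tendsto_zero_iff_norm_tendsto_zero.1 hx0)
    rw [norm_smul, Real.norm_eq_abs, abs_of_nonneg (Int.fract_nonneg _)]
    exact mul_le_of_le_one_left (norm_nonneg _) (Int.fract_lt_one _).le
  have h2 := (hy.const_smul t).sub h1
  rw [sub_zero] at h2
  refine hF.mem_of_tendsto h2 (Filter.Eventually.of_forall fun k => ?_)
  rw [smul_smul, ← sub_smul, Int.self_sub_fract, Int.cast_smul_eq_zsmul]
  exact F.zsmul_mem (hx k) _

/-- Near the origin, a closed additive subgroup is a vector subspace. -/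
theorem exists_nhds_inter_subset_maxSubspace [FiniteDimensional ℝ E] {F : AddSubgroup E}
    (hF : IsClosed (F : Set E)) : ∃ Ω : Set E, IsOpen Ω ∧ 0 ∈ Ω ∧ ∀ x ∈ Ω, x ∈ F →
      x ∈ maxSubspace F := by
  obtain ⟨W, hW⟩ := (maxSubspace F).exists_isCompl
  -- `F` meets a complement of its largest subspace discretely: otherwise the directions of a null
  -- sequence in `F ∩ W` would accumulate at a unit vector of `maxSubspace F ⊓ W`.
  have key : ∃ ε > 0, ∀ x ∈ F, x ∈ W → ‖x‖ < ε → x = 0 := by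
    by_contra! hc
    choose x hxF hxW hxn hx0 using fun k : ℕ => hc (1 / ((k : ℝ) + 1)) (by positivity)
    have hlim : Filter.Tendsto x Filter.atTop (𝓝 0) :=
      squeeze_zero_norm (fun k => (hxn k).le) tendsto_one_div_add_atTop_nhds_zero_nat
    have := FiniteDimensional.proper_real E
    obtain ⟨y, hy, φ, hφ, hlim'⟩ := (isCompact_sphere (0 : E) 1).tendsto_subseq
      (x := fun k => ‖x k‖⁻¹ • x k) fun k => by
        simp [norm_smul, inv_mul_cancel₀ (norm_ne_zero_iff.2 (hx0 k))]
    have hyV : y ∈ maxSubspace F := mem_maxSubspace_of_tendsto hF (x := x ∘ φ)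
      (fun k => hxF _) (hlim.comp hφ.tendsto_atTop) hlim'
    have hyW : y ∈ W := W.closed_of_finiteDimensional.mem_of_tendsto hlim'
      (Filter.Eventually.of_forall fun k => W.smul_mem _ (hxW _))
    have : y = 0 := by
      have := hW.inf_eq_bot.le (show y ∈ maxSubspace F ⊓ W from ⟨hyV, hyW⟩)
      simpa using this
    simp [this] at hy
  obtain ⟨ε, hε, h⟩ := key
  let π : E →ₗ[ℝ] W := W.projectionOnto (maxSubspace F) hW.symm
  have hπ : Continuous fun x => ‖π x‖ := π.continuous_of_finiteDimensional.norm
  refine ⟨{x | ‖π x‖ < ε}, isOpen_lt hπ continuous_const, by simpa using hε, fun x hx hxF => ?_⟩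
  have hd : x - π x ∈ maxSubspace F := by
    rw [← Submodule.ker_projectionOnto hW.symm, LinearMap.mem_ker, map_sub,
      Submodule.projectionOnto_apply_left hW.symm (π x)]
    exact sub_self _
  have hz := h (π x) (by simpa using F.sub_mem hxF (maxSubspace_le F hd)) (π x).2 hx
  rwa [hz, sub_zero] at hd

end ClosedSubgroup

/-! ### Submanifolds -/

section Submanifold

variable {E : Type*} [NormedAddCommGroup E] [NormedSpace ℝ E]

theorem IsSubmanifold.image {m : ℕ} {S : Set E} (hS : IsSubmanifold m S) (T : E ≃L[ℝ] E) :
    IsSubmanifold m (T '' S) := by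
  rintro _ ⟨x, hx, rfl⟩
  obtain ⟨e, V, hxe, he, he', hV, hS⟩ := hS x hx
  refine ⟨T.symm.toHomeomorph.toOpenPartialHomeomorph.trans e, V, ?_, ?_, ?_, hV, ?_⟩
  · simpa using hxe
  · refine he.comp T.symm.contDiff.contDiffOn ?_
    intro y hy
    simpa using hy
  · refine T.contDiff.comp_contDiffOn (he'.mono ?_)
    intro y hy
    simpa using hy
  · have h1 : (T.symm.toHomeomorph.toOpenPartialHomeomorph.trans e).source ∩ T '' S
        = T '' (e.source ∩ S) := by
      ext y
      constructor
      · rintro ⟨hy, z, hz, rfl⟩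
        exact ⟨z, ⟨by simpa using hy, hz⟩, rfl⟩
      · rintro ⟨z, hz, rfl⟩
        exact ⟨by simpa using hz.1, z, hz.2, rfl⟩
    rw [h1, image_image]
    simpa using hS

variable [FiniteDimensional ℝ E]

theorem mem_submodule_of_hasDerivAt {V : Submodule ℝ E} {f : ℝ → E} {f' : E}
    (hf : HasDerivAt f f' 0) (h : ∀ᶠ t in 𝓝 0, f t ∈ V) : f' ∈ V := by
  refine V.closed_of_finiteDimensional.mem_of_tendsto hf.tendsto_slope ?_
  filter_upwards [h.filter_mono nhdsWithin_le_nhds] with t ht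
  exact V.smul_mem _ (V.sub_mem ht h.self_of_nhds)

/-- The derivative of the transition map between two charts at `x` is injective and carries the
model space `V` into `V'`. -/
theorem IsSubmanifold.dim_le {m m' : ℕ} {C O O' : Set E} (hS : IsSubmanifold m (C ∩ O))
    (hS' : IsSubmanifold m' (C ∩ O')) (hO' : IsOpen O') {x : E} (hx : x ∈ C) (hxO : x ∈ O)
    (hxO' : x ∈ O') : m ≤ m' := by
  obtain ⟨e, V, hxe, he, he', hV, hS⟩ := hS x ⟨hx, hxO⟩
  obtain ⟨f, V', hxf, hf, hf', hV', hS'⟩ := hS' x ⟨hx, hxO'⟩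
  have hye := e.map_source hxe
  have hyf := f.map_source hxf
  have hyV : e x ∈ V := (hS.le ⟨x, ⟨hxe, hx, hxO⟩, rfl⟩).2
  have de := (he.contDiffAt (e.open_source.mem_nhds hxe)).differentiableAt (by simp)
  have de' := (he'.contDiffAt (e.open_target.mem_nhds hye)).differentiableAt (by simp)
  have df := (hf.contDiffAt (f.open_source.mem_nhds hxf)).differentiableAt (by simp)
  have df' := (hf'.contDiffAt (f.open_target.mem_nhds hyf)).differentiableAt (by simp)
  have d1 : DifferentiableAt ℝ (f ∘ e.symm) (e x) :=
    DifferentiableAt.comp _ (by rwa [e.left_inv hxe]) de'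
  have d2 : DifferentiableAt ℝ (e ∘ f.symm) (f x) :=
    DifferentiableAt.comp _ (by rwa [f.left_inv hxf]) df'
  set L := fderiv ℝ (f ∘ e.symm) (e x)
  have hfx : (f ∘ e.symm) (e x) = f x := by simp [e.left_inv hxe]
  have hcont : Filter.Tendsto e.symm (𝓝 (e x)) (𝓝 x) := by
    have := e.continuousAt_symm hye
    rwa [ContinuousAt, e.left_inv hxe] at this
  have hcomp : (fderiv ℝ (e ∘ f.symm) (f x)).comp L = ContinuousLinearMap.id ℝ E := by
    have h1 : HasFDerivAt ((e ∘ f.symm) ∘ (f ∘ e.symm)) _ (e x) :=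
      HasFDerivAt.comp _ (by rw [hfx]; exact d2.hasFDerivAt) d1.hasFDerivAt
    refine h1.unique ((hasFDerivAt_id _).congr_of_eventuallyEq ?_)
    filter_upwards [hcont (f.open_source.mem_nhds hxf), e.open_target.mem_nhds hye] with y hy hy'
    simp [f.left_inv hy, e.right_inv hy']
  have hinj : Function.Injective L := fun a b hab => by
    have := congrArg (fderiv ℝ (e ∘ f.symm) (f x)) hab
    simpa only [← ContinuousLinearMap.comp_apply, hcomp, ContinuousLinearMap.id_apply] using this
  -- The line `e x + t • v` stays in `V`, so for small `t` its image under the transition map stays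
  -- in `V'`; hence so does the velocity at `t = 0`.
  have hmap : ∀ v ∈ V, L v ∈ V' := by
    intro v hv
    have hline : HasDerivAt (fun t : ℝ => e x + t • v) v 0 := by
      simpa using ((hasDerivAt_id (0 : ℝ)).smul_const v).const_add (e x)
    have h0 : e x + (0 : ℝ) • v = e x := by simp
    have hd : HasDerivAt ((f ∘ e.symm) ∘ fun t : ℝ => e x + t • v) (L v) 0 :=
      HasFDerivAt.comp_hasDerivAt _ (by rw [h0]; exact d1.hasFDerivAt) hline
    refine mem_submodule_of_hasDerivAt hd ?_
    have hlim : Filter.Tendsto (fun t : ℝ => e x + t • v) (𝓝 0) (𝓝 (e x)) := by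
      have := hline.continuousAt.tendsto
      rwa [h0] at this
    filter_upwards [hlim (e.open_target.mem_nhds hye),
      hlim (hcont (f.open_source.mem_nhds hxf)), hlim (hcont (hO'.mem_nhds hxO'))] with t h1 h2 h3
    obtain ⟨z, ⟨hze, hzC, -⟩, hz⟩ := hS.ge ⟨h1, V.add_mem hyV (V.smul_mem t hv)⟩
    have hz' : e.symm (e x + t • v) = z := (congrArg e.symm hz).symm.trans (e.left_inv hze)
    simp only [mem_preimage, hz'] at h2 h3
    have := (hS'.le ⟨z, ⟨h2, hzC, h3⟩, rfl⟩).2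
    simpa [hz'] using this
  rw [← hV, ← hV']
  refine LinearMap.finrank_le_finrank_of_injective
    (f := (L : E →ₗ[ℝ] E).restrict (p := V) (q := V') hmap) fun a b hab => ?_
  exact Subtype.ext (hinj (congrArg Subtype.val hab))

end Submanifold

/-! ### Uniqueness of the order and invariance under linear isomorphisms -/

section Regular

variable {n : ℕ}

theorem IsRegularOfOrder.unique {m m' : ℕ} {γ : Set (Fin n → ℂ)} (h : IsRegularOfOrder m γ)
    (h' : IsRegularOfOrder m' γ) (hγ : γ.Nonempty) : m = m' := by
  obtain ⟨x, hx⟩ := hγ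
  obtain ⟨O, hO, hxO, hS⟩ := h x hx
  obtain ⟨O', hO', hxO', hS'⟩ := h' x hx
  exact le_antisymm (hS.dim_le hS' hO' (subset_closure hx) hxO hxO')
    (hS'.dim_le hS hO (subset_closure hx) hxO' hxO)

theorem isSubmanifold_image_closure_inter {m : ℕ} {γ O : Set (Fin n → ℂ)}
    (h : IsSubmanifold m (closure γ ∩ O)) (T : (Fin n → ℂ) ≃ₗ[ℂ] (Fin n → ℂ)) :
    IsSubmanifold m (closure (T '' γ) ∩ T '' O) := by
  let T' : (Fin n → ℂ) ≃L[ℝ] (Fin n → ℂ) := (T.restrictScalars ℝ).toContinuousLinearEquiv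
  have := h.image T'
  rwa [image_inter T'.injective, T'.image_closure] at this

theorem isOpen_image_linearEquiv {O : Set (Fin n → ℂ)} (hO : IsOpen O)
    (T : (Fin n → ℂ) ≃ₗ[ℂ] (Fin n → ℂ)) : IsOpen (T '' O) :=
  T.toContinuousLinearEquiv.toHomeomorph.isOpenMap O hO

theorem IsRegularOfOrder.image {m : ℕ} {γ : Set (Fin n → ℂ)} (h : IsRegularOfOrder m γ)
    (T : (Fin n → ℂ) ≃ₗ[ℂ] (Fin n → ℂ)) : IsRegularOfOrder m (T '' γ) := by
  rintro _ ⟨x, hx, rfl⟩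
  obtain ⟨O, hO, hxO, hS⟩ := h x hx
  exact ⟨T '' O, isOpen_image_linearEquiv hO T, mem_image_of_mem _ hxO,
    isSubmanifold_image_closure_inter hS T⟩

end Regular

/-! ### Charts from the inverse function theorem -/

/-- Near `0` the map `Ψ` is a diffeomorphism and `F` is a vector subspace. It identifies `F` with
`closure γ`: one inclusion is `hFγ`, the other follows from `hγF` because `F` is closed and the
local inverse is continuous. -/
theorem exists_isSubmanifold_of_chart {E : Type*} [NormedAddCommGroup E] [NormedSpace ℝ E]
    [FiniteDimensional ℝ E] {F : AddSubgroup E} (hF : IsClosed (F : Set E)) {γ : Set E}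
    {Ψ : E → E} (hΨ : ContDiff ℝ ∞ Ψ) (hΨ0 : HasFDerivAt Ψ (ContinuousLinearMap.id ℝ E) 0)
    (hFγ : ∀ z ∈ F, Ψ z ∈ closure γ) (hγF : ∀ z, Ψ z ∈ γ → z ∈ F) :
    ∃ O : Set E, IsOpen O ∧ Ψ 0 ∈ O ∧
      IsSubmanifold (Module.finrank ℝ (maxSubspace F)) (closure γ ∩ O) := by
  have : CompleteSpace E := FiniteDimensional.complete ℝ E
  obtain ⟨Ω, hΩ, h0Ω, hΩF⟩ := exists_nhds_inter_subset_maxSubspace hF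
  have hΨ0' : HasFDerivAt Ψ ((ContinuousLinearEquiv.refl ℝ E : E ≃L[ℝ] E) : E →L[ℝ] E) 0 := hΨ0
  let e₀ := hΨ.contDiffAt.toOpenPartialHomeomorph Ψ hΨ0' (by simp)
  have he₀ : (e₀ : E → E) = Ψ := hΨ.contDiffAt.toOpenPartialHomeomorph_coe hΨ0' (by simp)
  have h0 : (0 : E) ∈ e₀.source :=
    hΨ.contDiffAt.mem_toOpenPartialHomeomorph_source hΨ0' (by simp)
  -- Restricting to points with invertible derivative makes the local inverse smooth on its whole
  -- domain, not only at `Ψ 0`.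
  let D : Set E := fderiv ℝ Ψ ⁻¹' range ((↑) : (E ≃L[ℝ] E) → E →L[ℝ] E)
  have hD : IsOpen D := ContinuousLinearEquiv.isOpen.preimage (hΨ.continuous_fderiv (by simp))
  have h0D : (0 : E) ∈ D := ⟨ContinuousLinearEquiv.refl ℝ E, hΨ0.fderiv.symm⟩
  let e₁ := e₀.restrOpen (D ∩ Ω) (hD.inter hΩ)
  have hs : e₁.source = e₀.source ∩ (D ∩ Ω) := e₀.restrOpen_source _ _
  have he₁ : ∀ z, e₁ z = Ψ z := fun z => congrFun he₀ z
  have h0s : (0 : E) ∈ e₁.source := hs ▸ ⟨h0, h0D, h0Ω⟩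
  refine ⟨e₁.target, e₁.open_target, he₁ 0 ▸ e₁.map_source h0s, ?_⟩
  rintro x ⟨-, hx⟩
  refine ⟨e₁.symm, maxSubspace F, hx, ?_, ?_, rfl, ?_⟩
  · intro y hy
    obtain ⟨L, hL⟩ : e₁.symm y ∈ D := (hs ▸ e₁.map_target hy : _ ∈ _ ∩ (D ∩ Ω)).2.1
    refine (e₁.contDiffAt_symm hy (f₀' := L) ?_ ?_).contDiffWithinAt
    · rw [hL]
      exact (hΨ.differentiable (by simp) _).hasFDerivAt.congr_of_eventuallyEq
        (Filter.Eventually.of_forall he₁)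
    · exact hΨ.contDiffAt.congr_of_eventuallyEq (Filter.Eventually.of_forall he₁)
  · exact hΨ.contDiffOn.congr fun z _ => he₁ z
  · apply Subset.antisymm
    · rintro _ ⟨y, ⟨hyt, hy, -⟩, rfl⟩
      have hyt : y ∈ e₁.target := hyt
      have hys := e₁.map_target hyt
      refine ⟨hys, hΩF _ (hs ▸ hys : _ ∈ _ ∩ (D ∩ Ω)).2.2 ?_⟩
      have h1 : y ∈ closure (e₁.target ∩ γ) :=
        e₁.open_target.inter_closure ⟨hyt, hy⟩
      refine hF.closure_subset_iff.2 ?_ ((e₁.continuousAt_symm hyt).continuousWithinAt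
        |>.mem_closure_image h1)
      rintro _ ⟨w, ⟨hwt, hw⟩, rfl⟩
      exact hγF _ (by rwa [← he₁, e₁.right_inv hwt])
    · rintro z ⟨hz, hzF⟩
      have hz : z ∈ e₁.source := hz
      exact ⟨e₁ z, ⟨e₁.map_source hz, (he₁ z).symm ▸ hFγ z (maxSubspace_le F hzF),
        e₁.map_source hz⟩, e₁.left_inv hz⟩

/-! ### Algebras of matrices split into a semisimple and a nilpotent part -/

section Split

open NormedSpace

variable {n : ℕ} {ι : Type*} [Fintype ι]

/-- The subalgebra `𝒦` contains a central copy of `ι → ℂ` that complements the nilpotent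
matrices in `𝒦`. -/
structure IsSplit (𝒦 : Subalgebra ℂ (Matrix (Fin n) (Fin n) ℂ))
    (δ : (ι → ℂ) →ₐ[ℂ] Matrix (Fin n) (Fin n) ℂ) : Prop where
  injective : Function.Injective δ
  mem : ∀ μ, δ μ ∈ 𝒦
  commute : ∀ μ, ∀ X ∈ 𝒦, Commute (δ μ) X
  nilpotent : ∀ X ∈ 𝒦, ∃ μ, IsNilpotent (X - δ μ)

theorem exp_algHom_pi (δ : (ι → ℂ) →ₐ[ℂ] Matrix (Fin n) (Fin n) ℂ) (μ : ι → ℂ) :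
    exp (δ μ) = δ fun i => Complex.exp (μ i) := by
  have h : exp μ = fun i => Complex.exp (μ i) := by
    rw [Pi.exp_def, Complex.exp_eq_exp_ℂ]
  rw [← h]
  open scoped Matrix.Norms.Operator in
    exact (map_exp δ (LinearMap.continuous_of_finiteDimensional δ.toLinearMap) μ).symm

variable {𝒦 : Subalgebra ℂ (Matrix (Fin n) (Fin n) ℂ)}
  {δ : (ι → ℂ) →ₐ[ℂ] Matrix (Fin n) (Fin n) ℂ}

/-- The semisimple part `δ μ` of a unit is a unit, so `μ` has a coordinatewise logarithm; the
unipotent factor `δ μ⁻¹ * A` has a polynomial one. -/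
theorem IsSplit.exists_log (h : IsSplit 𝒦 δ) {A : Matrix (Fin n) (Fin n) ℂ} (hA : A ∈ 𝒦)
    (hu : IsUnit A) : ∃ B ∈ 𝒦, exp B = A := by
  classical
  obtain ⟨μ, hμ⟩ := h.nilpotent A hA
  have hδ : IsUnit (δ μ) := by
    have hc : Commute (-(A - δ μ)) A :=
      ((Commute.refl A).sub_left (h.commute μ A hA)).neg_left
    have := hμ.neg.isUnit_add_right_of_commute hu hc
    simpa using this
  have hμ0 : ∀ i, μ i ≠ 0 := fun i hi => by
    have h0 : δ μ * δ (Pi.single i 1) = 0 := by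
      rw [← map_mul, ← map_zero δ]
      congr 1
      ext j
      rcases eq_or_ne j i with rfl | hj <;> simp [*]
    have h1 : (Pi.single i 1 : ι → ℂ) = 0 :=
      h.injective (by rw [hδ.mul_right_eq_zero.1 h0, map_zero])
    simpa using congrFun h1 i
  have hinv : δ μ * δ μ⁻¹ = 1 := by
    rw [← map_mul, ← map_one δ]
    congr 1
    ext i
    simp [hμ0 i]
  have hM : IsNilpotent (δ μ⁻¹ * (A - δ μ)) :=
    (h.commute _ _ (𝒦.sub_mem hA (h.mem μ))).isNilpotent_mul_left hμ
  obtain ⟨N, hN, -, hexp⟩ := exists_log_one_add hM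
  have hN : N ∈ 𝒦 := (Algebra.adjoin_le (singleton_subset_iff.2
    (𝒦.mul_mem (h.mem _) (𝒦.sub_mem hA (h.mem μ))))) hN
  refine ⟨δ (fun i => Complex.log (μ i)) + N, 𝒦.add_mem (h.mem _) hN, ?_⟩
  rw [Matrix.exp_add_of_commute _ _ (h.commute _ _ hN), exp_algHom_pi, hexp]
  simp only [Complex.exp_log (hμ0 _)]
  rw [mul_add, ← mul_assoc, hinv]
  simp

/-- On the block of index `i`, `exp D` is `exp (μ i)` times a unipotent matrix. Fixing a nonzero
component of `u` forces `exp (μ i) = 1`, and then `N` kills that component. Blocks where `u`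
vanishes impose nothing. -/
theorem IsSplit.exists_exp_eq_one (h : IsSplit 𝒦 δ) {D : Matrix (Fin n) (Fin n) ℂ} (hD : D ∈ 𝒦)
    {u : Fin n → ℂ} (hu : exp D *ᵥ u = u) : ∃ μ, exp (δ μ) = 1 ∧ D *ᵥ u = δ μ *ᵥ u := by
  classical
  obtain ⟨μ, hN⟩ := h.nilpotent D hD
  set N := D - δ μ with hNdef
  have hN𝒦 : N ∈ 𝒦 := 𝒦.sub_mem hD (h.mem μ)
  have hDN : D = δ μ + N := by simp [N]
  have hexp : exp D = exp N * δ fun i => Complex.exp (μ i) := by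
    rw [hDN, add_comm, Matrix.exp_add_of_commute _ _ (h.commute _ _ hN𝒦).symm, exp_algHom_pi]
  let e : ι → Matrix (Fin n) (Fin n) ℂ := fun i => δ (Pi.single i 1)
  have hmul : ∀ (ν : ι → ℂ) i, δ ν * e i = ν i • e i := fun ν i => by
    rw [← map_mul, ← map_smul]
    congr 1
    ext j
    rcases eq_or_ne j i with rfl | hj <;> simp [*]
  have hsum : ∀ v, ∑ i, e i *ᵥ v = v := fun v => by
    rw [← Matrix.sum_mulVec, ← map_sum, Finset.univ_sum_single (fun _ : ι => (1 : ℂ))]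
    have : δ (fun _ => 1) = 1 := map_one δ
    rw [this, Matrix.one_mulVec]
  have hei : ∀ i, Complex.exp (μ i) • exp N *ᵥ (e i *ᵥ u) = e i *ᵥ u := fun i => by
    conv_rhs => rw [← hu]
    rw [Matrix.mulVec_mulVec, Matrix.mulVec_mulVec, ← Matrix.smul_mulVec,
      ((h.commute _ _ (exp_mem_subalgebra 𝒦 hD)).eq : e i * exp D = _), hexp, mul_assoc, hmul,
      Matrix.mul_smul]
  -- A nonzero `e i *ᵥ u` is an eigenvector of the nilpotent `exp N - 1` with eigenvalue `(exp (μ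
  -- i))⁻¹ - 1`, which must vanish.
  have h1 : ∀ i, e i *ᵥ u ≠ 0 → Complex.exp (μ i) = 1 := fun i hi => by
    by_contra hne
    obtain ⟨k, hk⟩ := isNilpotent_exp_sub_one hN
    have hz : ((Complex.exp (μ i))⁻¹ - 1) ≠ 0 := by
      rw [sub_ne_zero]
      simpa using hne
    have hstep : (exp N - 1) *ᵥ (e i *ᵥ u) = ((Complex.exp (μ i))⁻¹ - 1) • (e i *ᵥ u) := by
      rw [Matrix.sub_mulVec, Matrix.one_mulVec, sub_smul, one_smul]
      congr 1
      rw [eq_inv_smul_iff₀ (Complex.exp_ne_zero _)]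
      exact hei i
    have hpow : ∀ m : ℕ, (exp N - 1) ^ m *ᵥ (e i *ᵥ u) =
        ((Complex.exp (μ i))⁻¹ - 1) ^ m • (e i *ᵥ u) := fun m => by
      induction m with
      | zero => simp
      | succ m ih => rw [pow_succ, ← Matrix.mulVec_mulVec, hstep, Matrix.mulVec_smul, ih, smul_smul,
          pow_succ']
    have := hpow k
    rw [hk, Matrix.zero_mulVec, eq_comm, smul_eq_zero] at this
    exact this.elim (pow_ne_zero _ hz) hi
  have hNu : N *ᵥ u = 0 := by
    refine mulVec_eq_zero_of_exp_mulVec_eq hN ?_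
    conv_lhs => rw [← hsum u]
    conv_rhs => rw [← hsum u]
    rw [Matrix.mulVec_sum]
    refine Finset.sum_congr rfl fun i _ => ?_
    by_cases hi : e i *ᵥ u = 0
    · rw [hi, Matrix.mulVec_zero]
    · simpa [h1 i hi] using hei i
  -- Setting to `0` the coordinates that `u` does not see makes the exponential trivial on every
  -- block.
  refine ⟨fun i => if e i *ᵥ u = 0 then 0 else μ i, ?_, ?_⟩
  · rw [exp_algHom_pi, ← map_one δ]
    congr 1
    ext i
    by_cases hi : e i *ᵥ u = 0
    · simp [hi]
    · simp [hi, h1 i hi]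
  · rw [hDN, Matrix.add_mulVec, hNu, add_zero]
    have hν : ∀ ν : ι → ℂ, δ ν *ᵥ u = ∑ i, ν i • e i *ᵥ u := fun ν => by
      conv_lhs => rw [← hsum u]
      rw [Matrix.mulVec_sum]
      simp_rw [Matrix.mulVec_mulVec, hmul, Matrix.smul_mulVec]
    rw [hν, hν]
    refine Finset.sum_congr rfl fun i _ => ?_
    by_cases hi : e i *ᵥ u = 0 <;> simp [hi]

/-- Logarithms in `𝒦` of elements of a subalgebra containing the range of `δ` lie in it. -/
theorem IsSplit.mem_of_exp_mem (h : IsSplit 𝒦 δ) {𝒞 : Subalgebra ℂ (Matrix (Fin n) (Fin n) ℂ)}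
    (hδ : ∀ μ, δ μ ∈ 𝒞) {B : Matrix (Fin n) (Fin n) ℂ} (hB : B ∈ 𝒦) (hexp : exp B ∈ 𝒞) :
    B ∈ 𝒞 := by
  obtain ⟨μ, hN⟩ := h.nilpotent B hB
  set N := B - δ μ with hNdef
  have hN𝒦 : N ∈ 𝒦 := 𝒦.sub_mem hB (h.mem μ)
  have hexpN : exp N = exp B * exp (δ (-μ)) := by
    rw [← Matrix.exp_add_of_commute _ _ (h.commute _ _ hB).symm, map_neg, ← sub_eq_add_neg]
  have hmem : exp N - 1 ∈ 𝒞 := by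
    rw [hexpN, exp_algHom_pi]
    exact 𝒞.sub_mem (𝒞.mul_mem hexp (hδ _)) 𝒞.one_mem
  obtain ⟨N', hN', hnil, hN'exp⟩ := exists_log_one_add (isNilpotent_exp_sub_one hN)
  have hc : Commute N N' := by
    refine Algebra.commute_of_mem_adjoin_singleton_of_commute hN' ?_
    exact (Commute.exp_right (Commute.refl N)).sub_right (Commute.one_right N)
  -- Nilpotent logarithms are unique: `N` commutes with `N'`, and a nilpotent matrix with
  -- exponential `1` is zero.
  have heq : N - N' = 0 := by
    refine eq_zero_of_exp_eq_one (hc.isNilpotent_sub hN hnil) ?_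
    rw [sub_eq_add_neg, Matrix.exp_add_of_commute _ _ hc.neg_right, ← add_sub_cancel 1 (exp N),
      ← hN'exp, ← Matrix.exp_add_of_commute _ _ (Commute.refl N').neg_right, add_neg_cancel,
      exp_zero]
  have : B = N' + δ μ := by rw [← sub_eq_zero.1 heq, hNdef, sub_add_cancel]
  rw [this]
  exact 𝒞.add_mem (Algebra.adjoin_le (singleton_subset_iff.2 hmem) hN') (hδ μ)

end Split

/-! ### The closure of an orbit -/

section OrbitClosure

open NormedSpace

variable {n : ℕ}

/-- A linear section of `C ↦ C u` over its range, extended to the whole space. -/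
theorem exists_linearMap_mulVec_eq (𝒞 : Subalgebra ℂ (Matrix (Fin n) (Fin n) ℂ))
    (u : Fin n → ℂ) : ∃ L : (Fin n → ℂ) →ₗ[ℂ] Matrix (Fin n) (Fin n) ℂ,
      (∀ z, L z ∈ 𝒞) ∧ ∀ C ∈ 𝒞, L (C *ᵥ u) *ᵥ u = C *ᵥ u := by
  let ev : 𝒞 →ₗ[ℂ] (Fin n → ℂ) := (Matrix.mulVecBilin ℂ ℂ).flip u ∘ₗ 𝒞.val.toLinearMap
  obtain ⟨g, hg⟩ := ev.rangeRestrict.exists_rightInverse_of_surjective ev.range_rangeRestrict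
  obtain ⟨L, hL⟩ := g.exists_extend
  refine ⟨𝒞.val.toLinearMap ∘ₗ L, fun z => (L z).2, fun C hC => ?_⟩
  have h1 : C *ᵥ u = ((ev.rangeRestrict ⟨C, hC⟩ : LinearMap.range ev) : Fin n → ℂ) := rfl
  have h2 := LinearMap.congr_fun hL (ev.rangeRestrict ⟨C, hC⟩)
  have h3 := congrArg Subtype.val (LinearMap.congr_fun hg (ev.rangeRestrict ⟨C, hC⟩))
  rw [LinearMap.comp_apply, Submodule.subtype_apply] at h2
  rw [LinearMap.comp_apply, ← h2] at h3
  exact h3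

/-- The map `z ↦ exp (L z) u + (z - (L z) u)`, which straightens an orbit near `u`. -/
noncomputable def straighten (L : (Fin n → ℂ) →ₗ[ℂ] Matrix (Fin n) (Fin n) ℂ) (u : Fin n → ℂ)
    (z : Fin n → ℂ) : Fin n → ℂ :=
  exp (L z) *ᵥ u + (z - L z *ᵥ u)

section

open scoped Matrix.Norms.Operator

theorem contDiff_straighten (L : (Fin n → ℂ) →ₗ[ℂ] Matrix (Fin n) (Fin n) ℂ) (u : Fin n → ℂ) :
    ContDiff ℝ ∞ (straighten L u) := by
  let ev : Matrix (Fin n) (Fin n) ℂ →L[ℝ] (Fin n → ℂ) :=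
    LinearMap.toContinuousLinearMap (((Matrix.mulVecBilin ℂ ℂ).flip u).restrictScalars ℝ)
  let L' : (Fin n → ℂ) →L[ℝ] Matrix (Fin n) (Fin n) ℂ :=
    LinearMap.toContinuousLinearMap (L.restrictScalars ℝ)
  have hexp : ContDiff ℝ ∞ (exp : Matrix (Fin n) (Fin n) ℂ → Matrix (Fin n) (Fin n) ℂ) :=
    contDiff_iff_contDiffAt.2 fun X => (exp_analytic (𝕂 := ℝ) X).contDiffAt
  exact (ev.contDiff.comp (hexp.comp L'.contDiff)).add
    (contDiff_id.sub (ev.contDiff.comp L'.contDiff))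

theorem hasFDerivAt_straighten (L : (Fin n → ℂ) →ₗ[ℂ] Matrix (Fin n) (Fin n) ℂ)
    (u : Fin n → ℂ) :
    HasFDerivAt (straighten L u) (ContinuousLinearMap.id ℝ (Fin n → ℂ)) 0 := by
  let ev : Matrix (Fin n) (Fin n) ℂ →L[ℝ] (Fin n → ℂ) :=
    LinearMap.toContinuousLinearMap (((Matrix.mulVecBilin ℂ ℂ).flip u).restrictScalars ℝ)
  let L' : (Fin n → ℂ) →L[ℝ] Matrix (Fin n) (Fin n) ℂ :=
    LinearMap.toContinuousLinearMap (L.restrictScalars ℝ)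
  have hexp : HasFDerivAt (exp : Matrix (Fin n) (Fin n) ℂ → Matrix (Fin n) (Fin n) ℂ)
      (1 : Matrix (Fin n) (Fin n) ℂ →L[ℝ] Matrix (Fin n) (Fin n) ℂ) (L' 0) := by
    rw [map_zero]
    exact hasFDerivAt_exp_zero
  have h := ((ev.hasFDerivAt (x := exp (L' 0))).comp (0 : Fin n → ℂ)
    (hexp.comp (0 : Fin n → ℂ) L'.hasFDerivAt)).add ((hasFDerivAt_id (𝕜 := ℝ) (0 : Fin n → ℂ)).sub
      ((ev.hasFDerivAt (x := L' 0)).comp (0 : Fin n → ℂ) L'.hasFDerivAt))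
  have hid : ev.comp ((1 : Matrix (Fin n) (Fin n) ℂ →L[ℝ] Matrix (Fin n) (Fin n) ℂ).comp L') +
      (ContinuousLinearMap.id ℝ (Fin n → ℂ) - ev.comp L') = ContinuousLinearMap.id ℝ _ := by
    ext z
    simp
  rw [← hid]
  exact h

end

theorem mem_orbit_self (G : Subgroup (GL (Fin n) ℂ)) (u : Fin n → ℂ) : u ∈ orbit G u :=
  ⟨1, G.one_mem, by simp⟩

theorem image_orbit_of_mem {G : Subgroup (GL (Fin n) ℂ)} {A : GL (Fin n) ℂ} (hA : A ∈ G)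
    (u : Fin n → ℂ) : (Matrix.GeneralLinearGroup.toLin A).toLinearEquiv '' orbit G u =
      orbit G u := by
  have hT : ∀ (B : GL (Fin n) ℂ) v, (Matrix.GeneralLinearGroup.toLin B).toLinearEquiv v =
      (B : Matrix (Fin n) (Fin n) ℂ) *ᵥ v := fun B v => rfl
  ext w
  constructor
  · rintro ⟨_, ⟨B, hB, rfl⟩, rfl⟩
    exact ⟨A * B, G.mul_mem hA hB, by rw [hT, Matrix.mulVec_mulVec, Units.val_mul]⟩
  · rintro ⟨B, hB, rfl⟩
    refine ⟨_, ⟨A⁻¹ * B, G.mul_mem (G.inv_mem hA) hB, rfl⟩, ?_⟩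
    rw [hT, Matrix.mulVec_mulVec, ← Units.val_mul, mul_inv_cancel_left]

variable {ι : Type*} {𝒦 : Subalgebra ℂ (Matrix (Fin n) (Fin n) ℂ)}
  {δ : (ι → ℂ) →ₐ[ℂ] Matrix (Fin n) (Fin n) ℂ} {G : Subgroup (GL (Fin n) ℂ)}

/-- The subalgebra generated by `G` and the range of `δ`. -/
def splitAdjoin (G : Subgroup (GL (Fin n) ℂ)) (δ : (ι → ℂ) →ₐ[ℂ] Matrix (Fin n) (Fin n) ℂ) :
    Subalgebra ℂ (Matrix (Fin n) (Fin n) ℂ) :=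
  Algebra.adjoin ℂ ((fun A : GL (Fin n) ℂ => (A : Matrix (Fin n) (Fin n) ℂ)) '' G ∪ range δ)

theorem coe_mem_splitAdjoin {A : GL (Fin n) ℂ} (hA : A ∈ G) :
    (A : Matrix (Fin n) (Fin n) ℂ) ∈ splitAdjoin G δ :=
  Algebra.subset_adjoin (Or.inl ⟨A, hA, rfl⟩)

theorem map_mem_splitAdjoin (μ : ι → ℂ) : δ μ ∈ splitAdjoin G δ :=
  Algebra.subset_adjoin (Or.inr ⟨μ, rfl⟩)

theorem IsSplit.splitAdjoin_le (h : IsSplit 𝒦 δ)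
    (hG𝒦 : ∀ A ∈ G, (A : Matrix (Fin n) (Fin n) ℂ) ∈ 𝒦) : splitAdjoin G δ ≤ 𝒦 := by
  refine Algebra.adjoin_le (union_subset ?_ ?_)
  · rintro _ ⟨A, hA, rfl⟩
    exact hG𝒦 A hA
  · rintro _ ⟨μ, rfl⟩
    exact h.mem μ

theorem IsSplit.commute_of_mem_splitAdjoin (h : IsSplit 𝒦 δ)
    (hG𝒦 : ∀ A ∈ G, (A : Matrix (Fin n) (Fin n) ℂ) ∈ 𝒦)
    (hG : ∀ A ∈ G, ∀ B ∈ G, A * B = B * A) {X Y : Matrix (Fin n) (Fin n) ℂ}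
    (hX : X ∈ splitAdjoin G δ) (hY : Y ∈ splitAdjoin G δ) : Commute X Y := by
  refine Algebra.commute_of_mem_adjoin_of_forall_mem_commute hY fun S hS => ?_
  refine (Algebra.commute_of_mem_adjoin_of_forall_mem_commute hX fun R hR => ?_).symm
  rcases hS with ⟨A, hA, rfl⟩ | ⟨μ, rfl⟩
  · rcases hR with ⟨B, hB, rfl⟩ | ⟨ν, rfl⟩
    · exact congrArg Units.val (hG A hA B hB)
    · exact (h.commute ν _ (hG𝒦 A hA)).symm
  · rcases hR with ⟨B, hB, rfl⟩ | ⟨ν, rfl⟩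
    · exact h.commute μ _ (hG𝒦 B hB)
    · exact h.commute μ _ (h.mem ν)

variable [Fintype ι]

/-- The vectors `B u`, where `B` runs over the logarithms in `𝒦` of the elements of `G`. -/
def splitLogOrbit (h : IsSplit 𝒦 δ) (hG𝒦 : ∀ A ∈ G, (A : Matrix (Fin n) (Fin n) ℂ) ∈ 𝒦)
    (hG : ∀ A ∈ G, ∀ B ∈ G, A * B = B * A) (u : Fin n → ℂ) : AddSubgroup (Fin n → ℂ) where
  carrier := {w | ∃ B ∈ 𝒦, (∃ A ∈ G, exp B = (A : Matrix (Fin n) (Fin n) ℂ)) ∧ B *ᵥ u = w}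
  zero_mem' := ⟨0, 𝒦.zero_mem, ⟨1, G.one_mem, by simp⟩, by simp⟩
  neg_mem' := by
    rintro _ ⟨B, hB, ⟨A, hA, hexp⟩, rfl⟩
    refine ⟨-B, 𝒦.neg_mem hB, ⟨A⁻¹, G.inv_mem hA, ?_⟩, Matrix.neg_mulVec _ _⟩
    rw [Matrix.exp_neg, hexp, Matrix.coe_units_inv]
  add_mem' := by
    rintro _ _ ⟨B, hB, ⟨A, hA, hexp⟩, rfl⟩ ⟨B', hB', ⟨A', hA', hexp'⟩, rfl⟩
    refine ⟨B + B', 𝒦.add_mem hB hB', ⟨A * A', G.mul_mem hA hA', ?_⟩, Matrix.add_mulVec _ _ _⟩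
    -- Both logarithms lie in the commutative algebra `splitAdjoin G δ`, so their exponentials
    -- multiply.
    have hm := h.mem_of_exp_mem (𝒞 := splitAdjoin G δ) map_mem_splitAdjoin hB
      (hexp ▸ coe_mem_splitAdjoin hA)
    have hm' := h.mem_of_exp_mem (𝒞 := splitAdjoin G δ) map_mem_splitAdjoin hB'
      (hexp' ▸ coe_mem_splitAdjoin hA')
    rw [Matrix.exp_add_of_commute _ _ (h.commute_of_mem_splitAdjoin hG𝒦 hG hm hm'), hexp, hexp']
    rfl

/-- `exp (X - Y) - 1` is a left multiple of `X - Y`, so it kills `u`. Hence `exp(C) u` depends only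
on `C u` when `C` runs over a commutative algebra. -/
theorem exp_mulVec_eq_of_mulVec_eq {X Y : Matrix (Fin n) (Fin n) ℂ} (hXY : Commute X Y)
    {u : Fin n → ℂ} (h : X *ᵥ u = Y *ᵥ u) : exp X *ᵥ u = exp Y *ᵥ u := by
  obtain ⟨s, hs⟩ := exists_exp_aeval (X - Y) Polynomial.X
  have e : (1 + Polynomial.X + Polynomial.X ^ 2 * s : Polynomial ℂ) =
      1 + (1 + Polynomial.X * s) * Polynomial.X := by ring
  have hZ : exp (X - Y) *ᵥ u = u := by
    rw [e, map_add, map_one, map_mul, Polynomial.aeval_X] at hs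
    rw [hs, Matrix.add_mulVec, ← Matrix.mulVec_mulVec, Matrix.sub_mulVec, h, sub_self,
      Matrix.mulVec_zero, add_zero, Matrix.one_mulVec]
  have hXY' : Commute Y (X - Y) := hXY.symm.sub_right (Commute.refl Y)
  conv_lhs => rw [← add_sub_cancel Y X, Matrix.exp_add_of_commute _ _ hXY', ← Matrix.mulVec_mulVec,
    hZ]

/-- The closure of an orbit of an abelian linear group is a submanifold near the orbit. -/
theorem IsSplit.isRegularOfOrder (h : IsSplit 𝒦 δ)
    (hG𝒦 : ∀ A ∈ G, (A : Matrix (Fin n) (Fin n) ℂ) ∈ 𝒦)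
    (hG : ∀ A ∈ G, ∀ B ∈ G, A * B = B * A) (u : Fin n → ℂ) :
    IsRegularOfOrder
      (Module.finrank ℝ (maxSubspace (splitLogOrbit h hG𝒦 hG u).topologicalClosure))
      (orbit G u) := by
  set F := (splitLogOrbit h hG𝒦 hG u).topologicalClosure
  have h𝒞 : ∀ {X Y}, X ∈ splitAdjoin G δ → Y ∈ splitAdjoin G δ → Commute X Y :=
    h.commute_of_mem_splitAdjoin hG𝒦 hG
  have hlog : ∀ {B A}, B ∈ 𝒦 → A ∈ G → exp B = (A : Matrix (Fin n) (Fin n) ℂ) →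
      B ∈ splitAdjoin G δ := fun hB hA hexp =>
    h.mem_of_exp_mem map_mem_splitAdjoin hB (hexp ▸ coe_mem_splitAdjoin hA)
  obtain ⟨L, hL, hLu⟩ := exists_linearMap_mulVec_eq (splitAdjoin G δ) u
  have hforth : ∀ z ∈ F, straighten L u z ∈ closure (orbit G u) := by
    intro z hz
    refine map_mem_closure (contDiff_straighten L u).continuous hz ?_
    rintro _ ⟨B, hB, ⟨A, hA, hexp⟩, rfl⟩
    have hB' := hlog hB hA hexp
    refine ⟨A, hA, ?_⟩
    rw [straighten, exp_mulVec_eq_of_mulVec_eq (h𝒞 (hL _) hB') (hLu B hB'), hLu B hB', hexp,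
      sub_self, add_zero]
  have hback : ∀ z, straighten L u z ∈ orbit G u → z ∈ F := by
    rintro z ⟨A, hA, hAz⟩
    refine subset_closure ?_
    obtain ⟨B, hB, hexp⟩ := h.exists_log (hG𝒦 A hA) A.isUnit
    -- Solving the definition of `straighten` for `z` exhibits `z` as `C u` with `C ∈ splitAdjoin G
    -- δ`, where `L` is a true section.
    have hz : z = ((A : Matrix (Fin n) (Fin n) ℂ) - exp (L z) + L z) *ᵥ u := by
      rw [Matrix.add_mulVec, Matrix.sub_mulVec, hAz, straighten]
      abel
    have hLz : L z *ᵥ u = z := by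
      conv_lhs => rw [hz]
      conv_rhs => rw [hz]
      exact hLu _ (Subalgebra.add_mem _ (Subalgebra.sub_mem _ (coe_mem_splitAdjoin hA)
        (exp_mem_subalgebra _ (hL z))) (hL z))
    have hexpLz : exp (L z) *ᵥ u = exp B *ᵥ u := by
      rw [hexp, hAz, straighten, hLz, sub_self, add_zero]
    have hLz𝒦 := h.splitAdjoin_le hG𝒦 (hL z)
    have hcomm := h𝒞 (hL z) (hlog hB hA hexp)
    obtain ⟨μ, hμ, hμu⟩ := h.exists_exp_eq_one (𝒦.sub_mem hLz𝒦 hB) (u := u) (by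
      rw [sub_eq_add_neg, add_comm, Matrix.exp_add_of_commute _ _ hcomm.symm.neg_left,
        ← Matrix.mulVec_mulVec, hexpLz, Matrix.mulVec_mulVec,
        ← Matrix.exp_add_of_commute _ _ (Commute.refl B).neg_left, neg_add_cancel, exp_zero,
        Matrix.one_mulVec])
    -- Correcting `B` by the period `δ μ` keeps its exponential equal to `A` and moves `B u` to `z`.
    refine ⟨B + δ μ, 𝒦.add_mem hB (h.mem μ), ⟨A, hA, ?_⟩, ?_⟩
    · rw [Matrix.exp_add_of_commute _ _ (h.commute μ B hB).symm, hμ, mul_one, hexp]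
    · rw [Matrix.add_mulVec, ← hμu, Matrix.sub_mulVec, add_sub_cancel, hLz]
  obtain ⟨O, hO, huO, hS⟩ := exists_isSubmanifold_of_chart
    (splitLogOrbit h hG𝒦 hG u).isClosed_topologicalClosure (contDiff_straighten L u)
    (hasFDerivAt_straighten L u) hforth hback
  have h0 : straighten L u 0 = u := by simp [straighten]
  rw [h0] at huO
  rintro _ ⟨A, hA, rfl⟩
  let T : (Fin n → ℂ) ≃ₗ[ℂ] (Fin n → ℂ) := (Matrix.GeneralLinearGroup.toLin A).toLinearEquiv
  have := isSubmanifold_image_closure_inter hS T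
  rw [image_orbit_of_mem hA] at this
  exact ⟨T '' O, isOpen_image_linearEquiv hO T, mem_image_of_mem T huO, this⟩

end OrbitClosure

/-! ### Common eigenfunctionals of commuting endomorphisms -/

/-- Take a maximal proper invariant `H ⊇ W`. If `c` is an eigenvalue of `A` on `E ⧸ H`, then the
range of `A - c` together with `H` is proper and, by commutativity, invariant, so it is `H`. Any
functional vanishing on `H` is then an eigenfunctional. -/
theorem exists_common_eigenfunctional {E : Type*} [AddCommGroup E] [Module ℂ E]
    [FiniteDimensional ℂ E] {S : Set (Module.End ℂ E)} (hS : ∀ A ∈ S, ∀ B ∈ S, Commute A B)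
    {W : Submodule ℂ E} (hW : W ≠ ⊤) (hWS : ∀ A ∈ S, ∀ x ∈ W, A x ∈ W) :
    ∃ f : Module.Dual ℂ E, f ≠ 0 ∧ (∀ x ∈ W, f x = 0) ∧ ∀ A ∈ S, ∃ c : ℂ, ∀ x, f (A x) = c * f x := by
  obtain ⟨H, ⟨hWH, hH, hHS⟩, hmax⟩ := WellFounded.has_min
    (wellFounded_gt (α := Submodule ℂ E))
    {H | W ≤ H ∧ H ≠ ⊤ ∧ ∀ A ∈ S, ∀ x ∈ H, A x ∈ H} ⟨W, le_rfl, hW, hWS⟩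
  obtain ⟨f, hf, hfH⟩ := H.exists_le_ker_of_lt_top hH.lt_top
  refine ⟨f, hf, fun x hx => hfH (hWH hx), fun A hA => ?_⟩
  have : Nontrivial (E ⧸ H) := Submodule.Quotient.nontrivial_iff.2 hH
  let A' : Module.End ℂ (E ⧸ H) := H.mapQ H A (hHS A hA)
  obtain ⟨c, hc⟩ := Module.End.exists_eigenvalue A'
  refine ⟨c, fun x => ?_⟩
  let R : Submodule ℂ E := LinearMap.range (A - algebraMap ℂ (Module.End ℂ E) c)
  have hne : R ⊔ H ≠ ⊤ := by
    intro htop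
    have hsurj : Function.Surjective (A' - algebraMap ℂ (Module.End ℂ (E ⧸ H)) c) := by
      intro y
      obtain ⟨y, rfl⟩ := H.mkQ_surjective y
      obtain ⟨_, ⟨z, rfl⟩, h, hh, rfl⟩ := Submodule.mem_sup.1 (htop ▸ Submodule.mem_top : y ∈ R ⊔ H)
      refine ⟨H.mkQ z, ?_⟩
      have h0 : H.mkQ h = 0 := by simpa using hh
      rw [map_add, h0, add_zero]
      simp [A', Module.algebraMap_end_apply]
    obtain ⟨y, hy⟩ := hc.exists_hasEigenvector
    refine hy.2 (LinearMap.injective_iff_surjective.2 hsurj ?_)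
    rw [map_zero, LinearMap.sub_apply, hy.apply_eq_smul, Module.algebraMap_end_apply, sub_self]
  have hRH : R ⊔ H = H := by
    by_contra hlt
    refine hmax (R ⊔ H) ⟨hWH.trans le_sup_right, hne, fun B hB => ?_⟩
      (lt_of_le_of_ne le_sup_right (Ne.symm hlt))
    have hle : R ⊔ H ≤ (R ⊔ H).comap B := by
      refine sup_le ?_ fun x hx => Submodule.mem_sup_right (hHS B hB x hx)
      rintro _ ⟨z, rfl⟩
      refine Submodule.mem_sup_left ⟨B z, ?_⟩
      have := LinearMap.congr_fun (hS A hA B hB).eq z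
      simp only [Module.End.mul_apply] at this
      simp [Module.algebraMap_end_apply, this]
    exact fun x hx => hle hx
  have hx := hfH (hRH ▸ Submodule.mem_sup_left ⟨x, rfl⟩ :
    (A - algebraMap ℂ (Module.End ℂ E) c) x ∈ H)
  rw [LinearMap.mem_ker, LinearMap.sub_apply, map_sub, Module.algebraMap_end_apply, map_smul,
    sub_eq_zero] at hx
  simpa using hx

/-! ### The region of an orbit -/

section OrbitRegion

variable {n : ℕ} {G : Subgroup (GL (Fin n) ℂ)}

theorem orbit_mulVec {A : GL (Fin n) ℂ} (hA : A ∈ G) (v : Fin n → ℂ) :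
    orbit G ((A : Matrix (Fin n) (Fin n) ℂ) *ᵥ v) = orbit G v := by
  ext w
  constructor
  · rintro ⟨B, hB, rfl⟩
    exact ⟨B * A, G.mul_mem hB hA, by rw [Matrix.mulVec_mulVec, Units.val_mul]⟩
  · rintro ⟨B, hB, rfl⟩
    refine ⟨B * A⁻¹, G.mul_mem hB (G.inv_mem hA), ?_⟩
    rw [Matrix.mulVec_mulVec, ← Units.val_mul, inv_mul_cancel_right]

theorem mulVec_mem_orbitSpan {A : GL (Fin n) ℂ} (hA : A ∈ G) {u x : Fin n → ℂ}
    (hx : x ∈ orbitSpan G u) : (A : Matrix (Fin n) (Fin n) ℂ) *ᵥ x ∈ orbitSpan G u := by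
  have hle : orbitSpan G u ≤ (orbitSpan G u).comap (Matrix.mulVecLin (A : Matrix _ _ ℂ)) := by
    refine Submodule.span_le.2 ?_
    rintro _ ⟨B, hB, rfl⟩
    refine Submodule.subset_span ⟨A * B, G.mul_mem hA hB, ?_⟩
    rw [Units.val_mul, Matrix.mulVecLin_apply, Matrix.mulVec_mulVec]
  exact hle hx

theorem mem_orbitSpan_self (u : Fin n → ℂ) : u ∈ orbitSpan G u :=
  Submodule.subset_span (mem_orbit_self G u)

theorem orbitSpan_le {u : Fin n → ℂ} {W : Submodule ℂ (Fin n → ℂ)} (hW : IsInvariantSet G W)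
    (hu : u ∈ W) : orbitSpan G u ≤ W :=
  Submodule.span_le.2 (by rintro _ ⟨A, hA, rfl⟩; exact hW A hA u hu)

theorem exists_adjoin_mulVec_eq {v w : Fin n → ℂ} (hw : w ∈ orbitSpan G v) :
    ∃ M ∈ Algebra.adjoin ℂ ((fun A : GL (Fin n) ℂ => (A : Matrix (Fin n) (Fin n) ℂ)) '' G),
      M *ᵥ v = w := by
  let ev : Matrix (Fin n) (Fin n) ℂ →ₗ[ℂ] (Fin n → ℂ) := (Matrix.mulVecBilin ℂ ℂ).flip v
  have hle : orbitSpan G v ≤ (Subalgebra.toSubmodule (Algebra.adjoin ℂ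
      ((fun A : GL (Fin n) ℂ => (A : Matrix (Fin n) (Fin n) ℂ)) '' G))).map ev := by
    refine Submodule.span_le.2 ?_
    rintro _ ⟨A, hA, rfl⟩
    exact ⟨_, Algebra.subset_adjoin ⟨A, hA, rfl⟩, rfl⟩
  exact hle hw

theorem exists_linearEquiv_eqOn {V : Type*} [AddCommGroup V] [Module ℂ V] (W : Submodule ℂ V)
    (e : W ≃ₗ[ℂ] W) : ∃ T : V ≃ₗ[ℂ] V, ∀ x : W, T x = e x := by
  obtain ⟨Q, hQ⟩ := W.exists_isCompl
  refine ⟨(W.prodEquivOfIsCompl Q hQ).symm ≪≫ₗ (e.prodCongr (LinearEquiv.refl ℂ Q)) ≪≫ₗ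
    W.prodEquivOfIsCompl Q hQ, fun x => ?_⟩
  simp

/-- Write `w = M v` with `M` in the algebra generated by `G`. As `M` commutes with `G`, it carries
`A v` to `A w`, so it maps `E(v)` onto itself and is bijective there; the identity on a complement
extends it. -/
theorem exists_linearEquiv_image_orbit_eq (hG : ∀ A ∈ G, ∀ B ∈ G, A * B = B * A)
    {v w : Fin n → ℂ} (h : orbitSpan G v = orbitSpan G w) :
    ∃ T : (Fin n → ℂ) ≃ₗ[ℂ] (Fin n → ℂ), T '' orbit G v = orbit G w := by
  obtain ⟨M, hM, hMv⟩ := exists_adjoin_mulVec_eq (h ▸ mem_orbitSpan_self w : w ∈ orbitSpan G v)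
  have hcomm : ∀ A ∈ G, M * (A : Matrix (Fin n) (Fin n) ℂ) = A * M := fun A hA => by
    refine ((Algebra.commute_of_mem_adjoin_of_forall_mem_commute hM ?_).eq).symm
    rintro _ ⟨B, hB, rfl⟩
    exact congrArg Units.val (hG A hA B hB)
  have hMA : ∀ A ∈ G, M *ᵥ ((A : Matrix (Fin n) (Fin n) ℂ) *ᵥ v) =
      (A : Matrix (Fin n) (Fin n) ℂ) *ᵥ w := fun A hA => by
    rw [Matrix.mulVec_mulVec, hcomm A hA, ← Matrix.mulVec_mulVec, hMv]
  have himg : M.mulVecLin '' orbit G v = orbit G w := by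
    ext x
    constructor
    · rintro ⟨_, ⟨A, hA, rfl⟩, rfl⟩
      exact ⟨A, hA, (hMA A hA).symm⟩
    · rintro ⟨A, hA, rfl⟩
      exact ⟨_, ⟨A, hA, rfl⟩, hMA A hA⟩
  have hmap : (orbitSpan G v).map M.mulVecLin = orbitSpan G v := by
    conv_rhs => rw [h]
    rw [orbitSpan, Submodule.map_span, himg, orbitSpan]
  let m : orbitSpan G v →ₗ[ℂ] orbitSpan G v :=
    M.mulVecLin.restrict fun x hx => hmap.le ⟨x, hx, rfl⟩
  have hsurj : Function.Surjective m := fun y => by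
    obtain ⟨x, hx, hxy⟩ := hmap.ge y.2
    exact ⟨⟨x, hx⟩, Subtype.ext hxy⟩
  obtain ⟨T, hT⟩ := exists_linearEquiv_eqOn _
    (LinearEquiv.ofBijective m ⟨LinearMap.injective_iff_surjective.2 hsurj, hsurj⟩)
  refine ⟨T, ?_⟩
  rw [← himg]
  exact image_congr fun x hx => hT ⟨x, Submodule.subset_span hx⟩

/-- The functionals on `E(u)` which take the value `1` at `u` and whose kernel is invariant. -/
def normalizedFunctionals (G : Subgroup (GL (Fin n) ℂ)) (u : Fin n → ℂ) :
    Set (Module.Dual ℂ (orbitSpan G u)) :=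
  {f | f ⟨u, mem_orbitSpan_self u⟩ = 1 ∧ ∀ A, ∀ hA : A ∈ G, ∀ x : orbitSpan G u,
    f ⟨_, mulVec_mem_orbitSpan hA x.2⟩ =
      f ⟨_, mulVec_mem_orbitSpan hA (mem_orbitSpan_self u)⟩ * f x}

theorem dual_orbitSpan_ext {u : Fin n → ℂ} {f g : Module.Dual ℂ (orbitSpan G u)}
    (h : ∀ A, ∀ hA : A ∈ G, f ⟨_, mulVec_mem_orbitSpan hA (mem_orbitSpan_self u)⟩ =
      g ⟨_, mulVec_mem_orbitSpan hA (mem_orbitSpan_self u)⟩) : f = g := by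
  refine LinearMap.ext fun x => ?_
  have hle : orbitSpan G u ≤ (LinearMap.ker (f - g)).map (orbitSpan G u).subtype := by
    refine Submodule.span_le.2 ?_
    rintro _ ⟨A, hA, rfl⟩
    exact ⟨⟨_, mulVec_mem_orbitSpan hA (mem_orbitSpan_self u)⟩, sub_eq_zero.2 (h A hA), rfl⟩
  obtain ⟨y, hy, hyx⟩ := hle x.2
  rw [← Subtype.ext hyx]
  exact sub_eq_zero.1 hy

/-- Each such `f` is determined by `A ↦ f (A u)`, which is a character of `G`; distinct characters
are linearly independent by Dedekind. -/
theorem linearIndependent_normalizedFunctionals (G : Subgroup (GL (Fin n) ℂ)) (u : Fin n → ℂ) :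
    LinearIndependent ℂ ((↑) : normalizedFunctionals G u → Module.Dual ℂ (orbitSpan G u)) := by
  let Φ : Module.Dual ℂ (orbitSpan G u) →ₗ[ℂ] (G → ℂ) :=
    { toFun := fun f A => f ⟨_, mulVec_mem_orbitSpan A.2 (mem_orbitSpan_self u)⟩
      map_add' := fun _ _ => rfl
      map_smul' := fun _ _ => rfl }
  let χ : normalizedFunctionals G u → (G →* ℂ) := fun f =>
    { toFun := Φ f
      map_one' := by
        have := f.2.1
        simpa [Φ] using this
      map_mul' := fun A B => by
        have := f.2.2 A A.2 ⟨_, mulVec_mem_orbitSpan B.2 (mem_orbitSpan_self u)⟩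
        simpa only [Φ, LinearMap.coe_mk, AddHom.coe_mk, Matrix.mulVec_mulVec, Subgroup.coe_mul,
          Units.val_mul] using this }
  have hχ : Function.Injective χ := fun f g hfg => Subtype.ext <|
    dual_orbitSpan_ext fun A hA => DFunLike.congr_fun hfg ⟨A, hA⟩
  exact LinearIndependent.of_comp Φ ((linearIndependent_monoidHom G ℂ).comp χ hχ)

/-- A common eigenfunctional killing the proper subspace `E(v)` cannot vanish at `u`, or it would
vanish on the orbit that spans `E(u)`; so it can be normalized. -/
theorem exists_normalizedFunctional (hG : ∀ A ∈ G, ∀ B ∈ G, A * B = B * A) {u v : Fin n → ℂ}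
    (hv : v ∈ orbitSpan G u) (hne : orbitSpan G v ≠ orbitSpan G u) :
    ∃ f ∈ normalizedFunctionals G u, f ⟨v, hv⟩ = 0 := by
  let ρ : G → Module.End ℂ (orbitSpan G u) := fun A =>
    (Matrix.mulVecLin (A.1 : Matrix (Fin n) (Fin n) ℂ)).restrict
      fun x hx => mulVec_mem_orbitSpan A.2 hx
  have hW : (orbitSpan G v).comap (orbitSpan G u).subtype ≠ ⊤ := fun htop => hne <|
    le_antisymm (orbitSpan_le (fun A hA x hx => mulVec_mem_orbitSpan hA hx) hv)
      (Submodule.comap_subtype_eq_top.1 htop)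
  obtain ⟨f, hf, hfW, hfS⟩ := exists_common_eigenfunctional (S := range ρ) (by
      rintro _ ⟨A, rfl⟩ _ ⟨B, rfl⟩
      ext1 x
      refine Subtype.ext ?_
      change (A.1 : Matrix (Fin n) (Fin n) ℂ) *ᵥ ((B.1 : Matrix (Fin n) (Fin n) ℂ) *ᵥ x) =
        (B.1 : Matrix (Fin n) (Fin n) ℂ) *ᵥ ((A.1 : Matrix (Fin n) (Fin n) ℂ) *ᵥ x)
      rw [Matrix.mulVec_mulVec, Matrix.mulVec_mulVec]
      exact congrArg (fun M : GL (Fin n) ℂ => (M : Matrix (Fin n) (Fin n) ℂ) *ᵥ (x : Fin n → ℂ))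
        (hG A A.2 B B.2)) hW (by
      rintro _ ⟨A, rfl⟩ x hx
      exact mulVec_mem_orbitSpan A.2 hx)
  have hρ : ∀ A, ∀ hA : A ∈ G, ∃ c : ℂ, ∀ x : orbitSpan G u,
      f ⟨_, mulVec_mem_orbitSpan hA x.2⟩ = c * f x := fun A hA => hfS _ ⟨⟨A, hA⟩, rfl⟩
  set u' : orbitSpan G u := ⟨u, mem_orbitSpan_self u⟩ with hu'
  have hfu : f u' ≠ 0 := fun h0 => hf <| dual_orbitSpan_ext fun A hA => by
    obtain ⟨c, hc⟩ := hρ A hA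
    exact (hc u').trans (by rw [h0, mul_zero, LinearMap.zero_apply])
  refine ⟨(f u')⁻¹ • f, ⟨?_, fun A hA x => ?_⟩, ?_⟩
  · exact inv_mul_cancel₀ hfu
  · obtain ⟨c, hc⟩ := hρ A hA
    have h1 := hc x
    have h2 := hc u'
    simp only [LinearMap.smul_apply, smul_eq_mul]
    rw [h1, h2]
    field_simp
  · rw [LinearMap.smul_apply, hfW ⟨v, hv⟩ (mem_orbitSpan_self v), smul_zero]

/-- The vectors which generate the same space as `u`. -/
def generators (G : Subgroup (GL (Fin n) ℂ)) (u : Fin n → ℂ) : Set (Fin n → ℂ) :=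
  {v | orbitSpan G v = orbitSpan G u}

theorem mem_generators_iff (hG : ∀ A ∈ G, ∀ B ∈ G, A * B = B * A) {u v : Fin n → ℂ}
    (hv : v ∈ orbitSpan G u) :
    v ∈ generators G u ↔ ∀ f ∈ normalizedFunctionals G u, f ⟨v, hv⟩ ≠ 0 := by
  constructor
  · intro h f hf hfv
    have hle : orbitSpan G v ≤ (LinearMap.ker f).map (orbitSpan G u).subtype := by
      refine orbitSpan_le ?_ ⟨⟨v, hv⟩, hfv, rfl⟩
      rintro A hA _ ⟨x, hx, rfl⟩
      refine ⟨⟨_, mulVec_mem_orbitSpan hA x.2⟩, ?_, rfl⟩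
      have hx : f x = 0 := hx
      exact (hf.2 A hA x).trans (by rw [hx, mul_zero])
    obtain ⟨x, hx, hxu⟩ := hle (h.ge (mem_orbitSpan_self u))
    have hx : f x = 0 := hx
    have := hf.1
    rw [← show x = ⟨u, mem_orbitSpan_self u⟩ from Subtype.ext hxu, hx] at this
    exact zero_ne_one this
  · intro h
    by_contra hne
    obtain ⟨f, hf, hfv⟩ := exists_normalizedFunctional hG hv hne
    exact h f hf hfv

theorem isOrbitRegion_generators (hG : ∀ A ∈ G, ∀ B ∈ G, A * B = B * A) (u : Fin n → ℂ) :
    IsOrbitRegion G u (generators G u) := by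
  classical
  have hli := linearIndependent_normalizedFunctionals G u
  have hfin : (normalizedFunctionals G u).Finite := hli.setFinite
  let s : Finset (Submodule ℂ (Fin n → ℂ)) := hfin.toFinset.image fun f =>
    (LinearMap.ker f).map (orbitSpan G u).subtype
  have hsub : ∀ v ∈ generators G u, v ∈ orbitSpan G u := fun v hv => hv.le (mem_orbitSpan_self v)
  have hcompl : (orbitSpan G u : Set (Fin n → ℂ)) \ generators G u =
      ⋃ H ∈ s, (H : Set (Fin n → ℂ)) := by
    ext v
    simp only [mem_sdiff, SetLike.mem_coe, mem_iUnion, exists_prop, s, Finset.mem_image,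
      Set.Finite.mem_toFinset]
    constructor
    · rintro ⟨hv, hne⟩
      rw [mem_generators_iff hG hv] at hne
      push Not at hne
      obtain ⟨f, hf, hfv⟩ := hne
      exact ⟨_, ⟨f, hf, rfl⟩, ⟨v, hv⟩, hfv, rfl⟩
    · rintro ⟨_, ⟨f, hf, rfl⟩, x, hx, rfl⟩
      exact ⟨x.2, fun hgen => (mem_generators_iff hG x.2).1 hgen f hf hx⟩
  refine ⟨?_, rfl, ⟨(⋃ H ∈ s, (H : Set (Fin n → ℂ)))ᶜ, ?_, ?_⟩, ?_, fun v hv => hv, ?_,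
    s, ?_, ?_, hcompl⟩
  · intro A hA v hv
    exact (congrArg (Submodule.span ℂ) (orbit_mulVec hA v)).trans hv
  · exact (s.finite_toSet.isClosed_biUnion fun H _ =>
      H.closed_of_finiteDimensional).isOpen_compl
  · rw [← hcompl]
    ext v
    constructor
    · exact fun hv => ⟨hsub v hv, fun h => h.2 hv⟩
    · rintro ⟨hv, h⟩
      by_contra hne
      exact h ⟨hv, hne⟩
  · intro w hw
    have hlim : Filter.Tendsto (fun t : ℂ => w + t • u) (𝓝[≠] 0) (𝓝 w) := by
      have : Continuous fun t : ℂ => w + t • u := by fun_prop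
      have h := this.tendsto 0
      simp only [zero_smul, add_zero] at h
      exact h.mono_left nhdsWithin_le_nhds
    refine mem_closure_of_tendsto hlim ?_
    -- On the line `w + t • u` each functional equals `f w + t`, so only finitely many `t` are bad;
    -- `t = 0` is already excluded by the punctured neighbourhood.
    have hev : ∀ᶠ t : ℂ in 𝓝[≠] 0, ∀ f ∈ normalizedFunctionals G u, t ≠ -f ⟨w, hw⟩ := by
      rw [Filter.eventually_all_finite hfin]
      intro f _
      by_cases h0 : f ⟨w, hw⟩ = 0
      · filter_upwards [self_mem_nhdsWithin] with t ht
        simpa [h0] using ht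
      · exact nhdsWithin_le_nhds (isOpen_ne.mem_nhds (Ne.symm (neg_ne_zero.2 h0)))
    filter_upwards [hev] with t ht
    have hmem : w + t • u ∈ orbitSpan G u :=
      Submodule.add_mem _ hw (Submodule.smul_mem _ _ (mem_orbitSpan_self u))
    refine (mem_generators_iff hG hmem).2 fun f hf hz => ht f hf ?_
    have he : (⟨w + t • u, hmem⟩ : orbitSpan G u) = ⟨w, hw⟩ + t • ⟨u, mem_orbitSpan_self u⟩ := rfl
    rw [he, map_add, map_smul, hf.1, smul_eq_mul, mul_one] at hz
    exact eq_neg_of_add_eq_zero_right hz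
  · exact fun v hv w hw => exists_linearEquiv_image_orbit_eq hG (hv.trans hw.symm)
  · refine Finset.card_image_le.trans ?_
    have := hfin.fintype
    rw [Set.Finite.card_toFinset, orbitRank, ← Subspace.dual_finrank_eq]
    exact hli.fintype_card_le_finrank
  · intro H hH
    simp only [s, Finset.mem_image, Set.Finite.mem_toFinset] at hH
    obtain ⟨f, hf, rfl⟩ := hH
    refine ⟨Submodule.map_subtype_le _ _, ?_, ?_⟩
    · rw [Submodule.finrank_map_subtype_eq]
      have hr : LinearMap.range f = ⊤ := LinearMap.range_eq_top.2 fun c =>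
        ⟨c • ⟨u, mem_orbitSpan_self u⟩, by rw [map_smul, hf.1, smul_eq_mul, mul_one]⟩
      have := f.finrank_range_add_finrank_ker
      rw [hr, finrank_top, Module.finrank_self] at this
      rw [orbitRank, ← this, add_comm]
    · rintro A hA _ ⟨x, hx, rfl⟩
      refine ⟨⟨_, mulVec_mem_orbitSpan hA x.2⟩, ?_, rfl⟩
      have hx : f x = 0 := hx
      exact (hf.2 A hA x).trans (by rw [hx, mul_zero])

end OrbitRegion

/-! ### The algebra of block triangular matrices -/

section BlockTriangular

variable {n : ℕ}

/-- In terms of entries, closure under the algebra operations can be checked without reindexing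
blocks. -/
theorem blockTriangular_iff (η : Composition n) (M : Matrix (Fin n) (Fin n) ℂ) :
    M ∈ blockTriangular η ↔ (∀ i j, η.index i ≠ η.index j → M i j = 0) ∧
      (∀ i j, i < j → M i j = 0) ∧ ∃ μ : Fin η.length → ℂ, ∀ i, M i i = μ (η.index i) := by
  constructor
  · rintro ⟨T, hT, rfl⟩
    choose μ hμ using fun k => (hT k).1
    have hoff : ∀ i j, η.index i ≠ η.index j →
        Matrix.reindex η.blocksFinEquiv η.blocksFinEquiv (Matrix.blockDiagonal' T) i j = 0 :=
      fun i j hij => Matrix.blockDiagonal'_apply_ne T _ _ hij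
    refine ⟨hoff, fun i j hij => ?_, μ, fun i => ?_⟩
    · by_cases h : η.index i = η.index j
      · obtain ⟨⟨k, a⟩, rfl⟩ := η.blocksFinEquiv.surjective i
        obtain ⟨⟨l, b⟩, rfl⟩ := η.blocksFinEquiv.surjective j
        have hi : η.index (η.blocksFinEquiv ⟨k, a⟩) = k := η.index_embedding k a
        have hj : η.index (η.blocksFinEquiv ⟨l, b⟩) = l := η.index_embedding l b
        rw [hi, hj] at h
        subst h
        have hab : a < b := (η.embedding k).lt_iff_lt.1 hij
        simpa using (hT k).2 a b hab
      · exact hoff i j h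
    · obtain ⟨⟨k, a⟩, rfl⟩ := η.blocksFinEquiv.surjective i
      have hi : η.index (η.blocksFinEquiv ⟨k, a⟩) = k := η.index_embedding k a
      rw [hi]
      simpa using hμ k a
  · rintro ⟨hoff, hlow, μ, hμ⟩
    refine ⟨fun k => Matrix.of fun a b => M (η.embedding k a) (η.embedding k b), fun k => ⟨⟨μ k, fun a => ?_⟩,
      fun a b hab => hlow _ _ ((η.embedding k).lt_iff_lt.2 hab)⟩, ?_⟩
    · exact (hμ _).trans (by rw [η.index_embedding])
    · ext i j
      obtain ⟨⟨k, a⟩, rfl⟩ := η.blocksFinEquiv.surjective i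
      obtain ⟨⟨l, b⟩, rfl⟩ := η.blocksFinEquiv.surjective j
      have hi : η.index (η.blocksFinEquiv ⟨k, a⟩) = k := η.index_embedding k a
      have hj : η.index (η.blocksFinEquiv ⟨l, b⟩) = l := η.index_embedding l b
      by_cases h : k = l
      · subst h
        rw [Matrix.reindex_apply, Matrix.submatrix_apply, Equiv.symm_apply_apply,
          Equiv.symm_apply_apply, Matrix.blockDiagonal'_apply_eq]
        rfl
      · rw [hoff _ _ (by rwa [hi, hj]), Matrix.reindex_apply, Matrix.submatrix_apply,
          Equiv.symm_apply_apply, Equiv.symm_apply_apply, Matrix.blockDiagonal'_apply_ne _ _ _ h]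

theorem mul_apply_self_of_lowerTriangular {M N : Matrix (Fin n) (Fin n) ℂ}
    (hM : ∀ i j, i < j → M i j = 0) (hN : ∀ i j, i < j → N i j = 0) (i : Fin n) :
    (M * N) i i = M i i * N i i := by
  rw [Matrix.mul_apply]
  refine Finset.sum_eq_single i (fun l _ hl => ?_) (fun h => absurd (Finset.mem_univ i) h)
  rcases lt_or_gt_of_ne hl with h | h
  · rw [hN _ _ h, mul_zero]
  · rw [hM _ _ h, zero_mul]

/-- `𝒦_{η,r}(ℂ)` as a subalgebra. -/
def blockTriangularAlgebra (η : Composition n) : Subalgebra ℂ (Matrix (Fin n) (Fin n) ℂ) where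
  carrier := blockTriangular η
  mul_mem' {M N} hM hN := by
    rw [blockTriangular_iff] at *
    obtain ⟨hM, hM', μ, hμ⟩ := hM
    obtain ⟨hN, hN', ν, hν⟩ := hN
    refine ⟨fun i j hij => ?_, fun i j hij => ?_, fun k => μ k * ν k, fun i => ?_⟩
    · rw [Matrix.mul_apply]
      refine Finset.sum_eq_zero fun l _ => ?_
      by_cases h : η.index i = η.index l
      · rw [hN l j (h ▸ hij), mul_zero]
      · rw [hM i l h, zero_mul]
    · rw [Matrix.mul_apply]
      refine Finset.sum_eq_zero fun l _ => ?_
      rcases lt_or_ge i l with h | h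
      · rw [hM' i l h, zero_mul]
      · rw [hN' l j (h.trans_lt hij), mul_zero]
    · rw [mul_apply_self_of_lowerTriangular hM' hN', hμ, hν]
  add_mem' {M N} hM hN := by
    rw [blockTriangular_iff] at *
    obtain ⟨hM, hM', μ, hμ⟩ := hM
    obtain ⟨hN, hN', ν, hν⟩ := hN
    exact ⟨fun i j hij => by simp [hM i j hij, hN i j hij],
      fun i j hij => by simp [hM' i j hij, hN' i j hij], μ + ν, fun i => by simp [hμ, hν]⟩
  algebraMap_mem' c := by
    rw [blockTriangular_iff]
    refine ⟨fun i j hij => ?_, fun i j hij => ?_, fun _ => c, fun i => ?_⟩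
    · rw [Matrix.algebraMap_matrix_apply, if_neg fun h : i = j => hij (h ▸ rfl)]
    · rw [Matrix.algebraMap_matrix_apply, if_neg hij.ne]
    · simp [Matrix.algebraMap_matrix_apply]

/-- The diagonal matrices which are scalar on each block. -/
def blockScalar (η : Composition n) : (Fin η.length → ℂ) →ₐ[ℂ] Matrix (Fin n) (Fin n) ℂ :=
  (Matrix.diagonalAlgHom ℂ).comp (AlgHom.pi fun i => Pi.evalAlgHom ℂ _ (η.index i))

theorem blockScalar_apply (η : Composition n) (μ : Fin η.length → ℂ) :
    blockScalar η μ = Matrix.diagonal fun i => μ (η.index i) := rfl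

theorem isNilpotent_of_strictly_lowerTriangular {N : Matrix (Fin n) (Fin n) ℂ}
    (hN : ∀ i j, i ≤ j → N i j = 0) : IsNilpotent N := by
  have hup : Nᵀ.IsUpperTriangular := fun i j hij => hN j i (le_of_lt hij)
  have hc : N.charpoly = Polynomial.X ^ n := by
    rw [← Matrix.charpoly_transpose, Matrix.charpoly_of_isUpperTriangular _ hup]
    simp [hN _ _ le_rfl]
  exact ⟨n, by simpa [hc] using Matrix.aeval_self_charpoly N⟩

theorem isSplit_blockScalar (η : Composition n) :
    IsSplit (blockTriangularAlgebra η) (blockScalar η) where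
  injective μ ν h := by
    ext k
    -- Blocks are nonempty, so the first diagonal entry of block `k` recovers `μ k`.
    have := congrFun₂ h (η.embedding k ⟨0, η.one_le_blocksFun k⟩)
      (η.embedding k ⟨0, η.one_le_blocksFun k⟩)
    simpa [blockScalar_apply, η.index_embedding] using this
  mem μ := (blockTriangular_iff η _).2
    ⟨fun i j hij => Matrix.diagonal_apply_ne _ fun h => hij (h ▸ rfl),
      fun i j hij => Matrix.diagonal_apply_ne _ hij.ne, μ, fun i => Matrix.diagonal_apply_eq _ _⟩
  commute μ X hX := by
    ext i j
    rw [blockScalar_apply, Matrix.diagonal_mul, Matrix.mul_diagonal]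
    by_cases h : η.index i = η.index j
    · rw [h, mul_comm]
    · rw [((blockTriangular_iff η X).1 hX).1 i j h, mul_zero, zero_mul]
  nilpotent X hX := by
    obtain ⟨-, hlow, μ, hμ⟩ := (blockTriangular_iff η X).1 hX
    refine ⟨μ, isNilpotent_of_strictly_lowerTriangular fun i j hij => ?_⟩
    rcases hij.lt_or_eq with h | rfl
    · simp [blockScalar_apply, hlow i j h, Matrix.diagonal_apply_ne _ h.ne]
    · simp [blockScalar_apply, hμ]

/-- Conjugation by an invertible matrix. -/
def conjAlgEquiv (P : GL (Fin n) ℂ) :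
    Matrix (Fin n) (Fin n) ℂ ≃ₐ[ℂ] Matrix (Fin n) (Fin n) ℂ where
  toFun X := P * X * (P⁻¹ : GL (Fin n) ℂ)
  invFun X := (P⁻¹ : GL (Fin n) ℂ) * X * P
  left_inv X := by simp [mul_assoc]
  right_inv X := by simp [mul_assoc]
  map_mul' X Y := by simp [mul_assoc]
  map_add' X Y := by simp [mul_add, add_mul]
  commutes' c := by simp [← Algebra.commutes c (P : Matrix (Fin n) (Fin n) ℂ), mul_assoc]

theorem IsSplit.map {ι : Type*} {𝒦 : Subalgebra ℂ (Matrix (Fin n) (Fin n) ℂ)}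
    {δ : (ι → ℂ) →ₐ[ℂ] Matrix (Fin n) (Fin n) ℂ} (h : IsSplit 𝒦 δ)
    (Φ : Matrix (Fin n) (Fin n) ℂ ≃ₐ[ℂ] Matrix (Fin n) (Fin n) ℂ) :
    IsSplit (𝒦.map Φ.toAlgHom) (Φ.toAlgHom.comp δ) where
  injective := Φ.injective.comp h.injective
  mem μ := ⟨_, h.mem μ, rfl⟩
  commute := by
    rintro μ _ ⟨X, hX, rfl⟩
    exact (h.commute μ X hX).map Φ.toAlgHom
  nilpotent := by
    rintro _ ⟨X, hX, rfl⟩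
    obtain ⟨μ, hμ⟩ := h.nilpotent X hX
    refine ⟨μ, ?_⟩
    have := hμ.map Φ.toAlgHom
    rwa [map_sub] at this

end BlockTriangular

/-! ### Existence of a normal form -/

section NormalForm

open Module

/-- A common eigenfunctional `f` of nilpotent maps has eigenvalues zero, so all images lie in `ker
f`. Induct on `ker f` and put a vector outside it first. -/
theorem exists_basis_strictly_lowerTriangular {E : Type*} [AddCommGroup E] [Module ℂ E]
    [FiniteDimensional ℂ E] {d : ℕ} (hd : finrank ℂ E = d) {S : Set (End ℂ E)}
    (hS : ∀ A ∈ S, ∀ B ∈ S, Commute A B) (hnil : ∀ A ∈ S, IsNilpotent A) :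
    ∃ b : Basis (Fin d) ℂ E, ∀ A ∈ S, ∀ i j, i ≤ j → b.repr (A (b j)) i = 0 := by
  induction d generalizing E with
  | zero => exact ⟨finBasisOfFinrankEq ℂ E hd, fun _ _ i => i.elim0⟩
  | succ d ih =>
    have : Nontrivial E := nontrivial_of_finrank_eq_succ hd
    obtain ⟨f, hf, -, hfS⟩ := exists_common_eigenfunctional hS (W := ⊥) bot_ne_top (by simp)
    obtain ⟨y, hy⟩ : ∃ y, f y ≠ 0 := by
      by_contra! h
      exact hf (LinearMap.ext h)
    have hker : ∀ A ∈ S, ∀ x, f (A x) = 0 := fun A hA x => by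
      obtain ⟨c, hc⟩ := hfS A hA
      obtain ⟨k, hk⟩ := hnil A hA
      have hpow : ∀ (m : ℕ) z, f ((A ^ m) z) = c ^ m * f z := fun m => by
        induction m with
        | zero => simp
        | succ m ihm =>
          intro z
          rw [pow_succ, Module.End.mul_apply, ihm, hc, pow_succ, mul_assoc]
      have h0 := hpow k y
      rw [hk, LinearMap.zero_apply, map_zero, eq_comm, mul_eq_zero] at h0
      rw [hc, eq_zero_of_pow_eq_zero (h0.resolve_right hy), zero_mul]
    have hfin : finrank ℂ (LinearMap.ker f) = d := by
      have hr : LinearMap.range f = ⊤ := LinearMap.range_eq_top.2 fun c =>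
        ⟨(c / f y) • y, by rw [map_smul, smul_eq_mul, div_mul_cancel₀ _ hy]⟩
      have := f.finrank_range_add_finrank_ker
      rw [hr, finrank_top, finrank_self, hd] at this
      omega
    let S' : Set (End ℂ (LinearMap.ker f)) := {B | ∃ A ∈ S, ∀ x, (B x : E) = A x}
    obtain ⟨b', hb'⟩ := ih hfin (S := S')
      (by
        rintro B ⟨A, hA, hBA⟩ B' ⟨A', hA', hBA'⟩
        ext x
        simpa [hBA, hBA'] using LinearMap.congr_fun (hS A hA A' hA').eq (x : E))
      (by
        rintro B ⟨A, hA, hBA⟩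
        obtain ⟨k, hk⟩ := hnil A hA
        have hpow : ∀ (m : ℕ) x, ((B ^ m) x : E) = (A ^ m) x := fun m => by
          induction m with
          | zero => simp
          | succ m ihm =>
            intro x
            rw [pow_succ, pow_succ, Module.End.mul_apply, Module.End.mul_apply, ihm, hBA]
        exact ⟨k, by ext x; rw [hpow, hk]; rfl⟩)
    let b : Basis (Fin (d + 1)) ℂ E := Basis.mkFinCons y b'
      (fun c x hx h => by
        have := congrArg f h
        rw [map_add, map_smul, LinearMap.mem_ker.1 hx, add_zero, map_zero, smul_eq_zero] at this
        exact this.resolve_right hy)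
      (fun z => ⟨-(f z / f y), by
        rw [LinearMap.mem_ker, map_add, map_smul, smul_eq_mul, neg_mul, div_mul_cancel₀ _ hy,
          add_neg_cancel]⟩)
    have hb0 : b 0 = y := by simp [b]
    have hbs : ∀ j : Fin d, b j.succ = b' j := fun j => by simp [b]
    have hcoord0 : ∀ x : LinearMap.ker f, b.repr x 0 = 0 := fun x => by
      have : (b.coord 0).comp (LinearMap.ker f).subtype = 0 := b'.ext fun j => by
        simp [← hbs]
      exact LinearMap.congr_fun this x
    have hcoords : ∀ (x : LinearMap.ker f) (i : Fin d), b.repr x i.succ = b'.repr x i :=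
      fun x i => by
        have : (b.coord i.succ).comp (LinearMap.ker f).subtype = b'.coord i := b'.ext fun j => by
          simp [← hbs, Finsupp.single_apply]
        exact LinearMap.congr_fun this x
    refine ⟨b, fun A hA i j hij => ?_⟩
    have hAj : A (b j) ∈ LinearMap.ker f := hker A hA _
    induction i using Fin.cases with
    | zero => exact hcoord0 ⟨_, hAj⟩
    | succ i =>
      induction j using Fin.cases with
      | zero => exact absurd hij (by simp)
      | succ j =>
        let B : End ℂ (LinearMap.ker f) := A.restrict fun x _ => hker A hA x
        have hB := hb' B ⟨A, hA, fun _ => rfl⟩ i j (Fin.succ_le_succ_iff.1 hij)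
        rw [← hcoords] at hB
        rw [hbs]
        exact hB

/-- Joint generalized eigenspaces are independent, so only finitely many are nonzero; these are
enumerated. -/
theorem exists_isInternal_iInf_maxGenEigenspace {V κ : Type*} [AddCommGroup V] [Module ℂ V]
    [FiniteDimensional ℂ V] (T : κ → End ℂ V) (hT : ∀ i j, Commute (T i) (T j)) :
    ∃ (r : ℕ) (χ : Fin r → κ → ℂ),
      DirectSum.IsInternal (fun k => ⨅ i, (T i).maxGenEigenspace (χ k i)) ∧
      ∀ k, ⨅ i, (T i).maxGenEigenspace (χ k i) ≠ ⊥ := by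
  have hind := End.independent_iInf_maxGenEigenspace_of_forall_mapsTo T fun i j φ =>
    End.mapsTo_maxGenEigenspace_of_comm (hT j i) φ
  have htop := End.iSup_iInf_maxGenEigenspace_eq_top_of_forall_mapsTo T
    (fun i j φ => End.mapsTo_maxGenEigenspace_of_comm (hT j i) φ)
    fun i => End.iSup_maxGenEigenspace_eq_top (T i)
  set N := fun χ : κ → ℂ => ⨅ i, (T i).maxGenEigenspace (χ i)
  have hfin : Finite {χ // N χ ≠ ⊥} := WellFoundedGT.finite_ne_bot_of_iSupIndep hind
  obtain ⟨r, ⟨e⟩⟩ := Finite.exists_equiv_fin {χ // N χ ≠ ⊥}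
  refine ⟨r, fun k => (e.symm k).1, DirectSum.isInternal_submodule_of_iSupIndep_of_iSup_eq_top
    (hind.comp (Subtype.val_injective.comp e.symm.injective)) ?_, fun k => (e.symm k).2⟩
  rw [← htop, ← iSup_ne_bot_subtype N]
  exact e.symm.iSup_comp (g := fun χ : {χ // N χ ≠ ⊥} => N χ.1)

theorem exists_composition_isInternal {n : ℕ} {κ : Type*} (T : κ → End ℂ (Fin n → ℂ))
    (hT : ∀ i j, Commute (T i) (T j)) :
    ∃ (η : Composition n) (χ : Fin η.length → κ → ℂ),
      DirectSum.IsInternal (fun k => ⨅ i, (T i).maxGenEigenspace (χ k i)) ∧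
      ∀ k, finrank ℂ (⨅ i, (T i).maxGenEigenspace (χ k i) : Submodule ℂ (Fin n → ℂ)) =
        η.blocksFun k := by
  obtain ⟨r, χ, hint, hne⟩ := exists_isInternal_iInf_maxGenEigenspace T hT
  let d : Fin r → ℕ := fun k =>
    finrank ℂ (⨅ i, (T i).maxGenEigenspace (χ k i) : Submodule ℂ (Fin n → ℂ))
  have hsum : ∑ k, d k = n := by
    have := finrank_eq_card_basis (hint.collectedBasis fun k => finBasis ℂ _)
    simpa [d] using this.symm
  let η : Composition n := ⟨List.ofFn d, by
      intro i hi
      obtain ⟨k, rfl⟩ := (List.mem_ofFn' _ _).1 hi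
      exact Nat.pos_of_ne_zero fun h => hne k (Submodule.finrank_eq_zero.1 h), by
      rw [List.sum_ofFn, hsum]⟩
  have hlen : η.length = r := List.length_ofFn
  let σ : Fin η.length ≃ Fin r := finCongr hlen
  refine ⟨η, fun k => χ (σ k), DirectSum.isInternal_submodule_of_iSupIndep_of_iSup_eq_top
    (hint.submodule_iSupIndep.comp σ.injective) ?_, fun k => ?_⟩
  · rw [← hint.submodule_iSup_eq_top]
    exact σ.iSup_comp (g := fun k => ⨅ i, (T i).maxGenEigenspace (χ k i))
  · exact (List.get_ofFn d k).symm

theorem commute_sub_algebraMap {R : Type*} [Ring R] [Algebra ℂ R] {a b : R} (h : Commute a b)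
    (c d : ℂ) : Commute (a - algebraMap ℂ R c) (b - algebraMap ℂ R d) :=
  (h.sub_right (Algebra.commute_algebraMap_right d a)).sub_left
    (Algebra.commute_algebraMap_left c _)

/-- On a joint generalized eigenspace the maps `A - χ(A)` are commuting nilpotents. A basis making
them strictly lower triangular gives `A` the constant diagonal `χ(A)`. -/
theorem exists_isNormalForm {n : ℕ} {G : Subgroup (GL (Fin n) ℂ)}
    (hG : ∀ A ∈ G, ∀ B ∈ G, A * B = B * A) :
    ∃ (P : GL (Fin n) ℂ) (η : Composition n), IsNormalForm G P η := by
  let T : G → End ℂ (Fin n → ℂ) := fun A => Matrix.toLin' (A.1 : Matrix (Fin n) (Fin n) ℂ)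
  have hT : ∀ A B, Commute (T A) (T B) := fun A B => by
    have : Commute (A.1 : Matrix (Fin n) (Fin n) ℂ) (B.1 : Matrix (Fin n) (Fin n) ℂ) :=
      congrArg Units.val (hG A A.2 B B.2)
    exact this.map (Matrix.toLinAlgEquiv' (R := ℂ) (n := Fin n))
  obtain ⟨η, χ, hint, hrank⟩ := exists_composition_isInternal T hT
  set N : Fin η.length → Submodule ℂ (Fin n → ℂ) := fun k =>
    ⨅ i, (T i).maxGenEigenspace (χ k i) with hN
  have hmaps : ∀ A k, MapsTo (T A) (N k) (N k) := fun A k x hx => by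
    simp only [hN, SetLike.mem_coe, Submodule.mem_iInf] at hx ⊢
    exact fun B => End.mapsTo_maxGenEigenspace_of_comm (hT B A) _ (hx B)
  let R : ∀ k, G → End ℂ (N k) := fun k A => (T A).restrict (hmaps A k)
  have hR : ∀ k A B, Commute (R k A) (R k B) := fun k A B => by
    ext1 x
    exact Subtype.ext (LinearMap.congr_fun (hT A B).eq (x : Fin n → ℂ))
  have hnil : ∀ k A, IsNilpotent (R k A - algebraMap ℂ (End ℂ (N k)) (χ k A)) := fun k A =>
    End.isNilpotent_restrict_of_le (f := T A - algebraMap ℂ _ (χ k A)) (p := N k)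
      (hp := fun x hx => (N k).sub_mem (hmaps A k hx) ((N k).smul_mem _ hx)) (iInf_le _ A)
      (End.isNilpotent_restrict_maxGenEigenspace_sub_algebraMap (T A) (χ k A))
  choose b hb using fun k => exists_basis_strictly_lowerTriangular (hrank k)
    (S := range fun A => R k A - algebraMap ℂ (End ℂ (N k)) (χ k A))
    (by
      rintro _ ⟨A, rfl⟩ _ ⟨B, rfl⟩
      exact commute_sub_algebraMap (R := End ℂ (N k)) (hR k A B) _ _)
    (by
      rintro _ ⟨A, rfl⟩
      exact hnil k A)
  have htri : ∀ k A, LinearMap.toMatrix (b k) (b k) (R k A) ∈ triangular (η.blocksFun k) := by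
    intro k A
    have h : ∀ i j, i ≤ j → LinearMap.toMatrix (b k) (b k) (R k A) i j =
        if i = j then χ k A else 0 := fun i j hij => by
      have := hb k _ ⟨A, rfl⟩ i j hij
      rw [LinearMap.sub_apply, map_sub, Finsupp.sub_apply, sub_eq_zero,
        Module.algebraMap_end_apply, map_smul, Basis.repr_self, Finsupp.smul_apply,
        Finsupp.single_apply] at this
      rw [LinearMap.toMatrix_apply, this]
      simp [eq_comm]
    exact ⟨⟨χ k A, fun i => by simpa using h i i le_rfl⟩, fun i j hij => by
      simpa [hij.ne] using h i j hij.le⟩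
  let c : Basis (Fin n) ℂ (Fin n → ℂ) := (hint.collectedBasis b).reindex η.blocksFinEquiv
  let s : Basis (Fin n) ℂ (Fin n → ℂ) := Pi.basisFun ℂ (Fin n)
  -- The columns of `P` are the collected basis, so conjugating by `P` is the change of basis.
  let P : GL (Fin n) ℂ := ⟨s.toMatrix c, c.toMatrix s, s.toMatrix_mul_toMatrix_flip c,
    c.toMatrix_mul_toMatrix_flip s⟩
  refine ⟨P, η, fun A hA => ⟨fun k => LinearMap.toMatrix (b k) (b k) (R k ⟨A, hA⟩),
    fun k => htri k ⟨A, hA⟩, ?_⟩⟩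
  have h1 : ((P⁻¹ * A * P : GL (Fin n) ℂ) : Matrix (Fin n) (Fin n) ℂ) =
      LinearMap.toMatrix c c (T ⟨A, hA⟩) := by
    rw [← basis_toMatrix_mul_linearMap_toMatrix_mul_basis_toMatrix c s c s]
    have : LinearMap.toMatrix s s (T ⟨A, hA⟩) = A := LinearMap.toMatrix'_toLin' _
    rw [this]
    rfl
  rw [h1, ← LinearMap.toMatrix_directSum_collectedBasis_eq_blockDiagonal' hint hint b b
    (hmaps ⟨A, hA⟩)]
  ext i j
  simp [c, LinearMap.toMatrix_apply]

end NormalForm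

/-! ### The order of an orbit and the dimension of `g_u` -/

section Main

open NormedSpace

variable {n : ℕ} {G : Subgroup (GL (Fin n) ℂ)} {P : GL (Fin n) ℂ} {η : Composition n}

theorem IsNormalForm.mem_map_conj (hP : IsNormalForm G P η) {A : GL (Fin n) ℂ} (hA : A ∈ G) :
    (A : Matrix (Fin n) (Fin n) ℂ) ∈
      (blockTriangularAlgebra η).map (conjAlgEquiv P).toAlgHom := by
  refine ⟨_, hP A hA, ?_⟩
  change (P : Matrix (Fin n) (Fin n) ℂ) * ((P⁻¹ * A * P : GL (Fin n) ℂ) : Matrix (Fin n) (Fin n) ℂ) *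
    ((P⁻¹ : GL (Fin n) ℂ) : Matrix (Fin n) (Fin n) ℂ) = (A : Matrix (Fin n) (Fin n) ℂ)
  rw [← Units.val_mul, ← Units.val_mul]
  congr 1
  group

theorem logOrbit_eq (hG : ∀ A ∈ G, ∀ B ∈ G, A * B = B * A) (hP : IsNormalForm G P η)
    (u : Fin n → ℂ) : logOrbit G P η u = splitLogOrbit
      ((isSplit_blockScalar η).map (conjAlgEquiv P)) (fun _ hA => hP.mem_map_conj hA) hG u := by
  ext w
  constructor
  · rintro ⟨B, ⟨hB, M, hM, rfl⟩, rfl⟩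
    exact ⟨_, ⟨M, hM, rfl⟩, hB, rfl⟩
  · rintro ⟨_, ⟨M, hM, rfl⟩, hB, rfl⟩
    exact ⟨_, ⟨hB, M, hM, rfl⟩, rfl⟩

/-- The orbit is always regular, so by uniqueness of the order both sides say that `m` is the
dimension of the largest subspace in the closure of `g_u`. -/
theorem isRegularOfOrder_iff_hasRealDim (hG : ∀ A ∈ G, ∀ B ∈ G, A * B = B * A)
    (hP : IsNormalForm G P η) (u : Fin n → ℂ) (m : ℕ) :
    IsRegularOfOrder m (orbit G u) ↔ HasRealDim (closure (logOrbit G P η u)) m := by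
  have hreg := ((isSplit_blockScalar η).map (conjAlgEquiv P)).isRegularOfOrder
    (fun _ hA => hP.mem_map_conj hA) hG u
  rw [logOrbit_eq hG hP, ← AddSubgroup.topologicalClosure_coe, hasRealDim_iff]
  exact ⟨fun h => h.unique hreg ⟨u, mem_orbit_self G u⟩, fun h => h ▸ hreg⟩

end Main

end AbelianLinear

theorem theoremT (n : ℕ) (G : Subgroup (GL (Fin n) ℂ))
    (hG : ∀ A ∈ G, ∀ B ∈ G, A * B = B * A) (u : Fin n → ℂ) :
    -- the region `U_u` and a normal form of `G` exist
    (∃ U : Set (Fin n → ℂ), AbelianLinear.IsOrbitRegion G u U) ∧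
    (∃ (P : GL (Fin n) ℂ) (η : Composition n), AbelianLinear.IsNormalForm G P η) ∧
    -- and, whatever the choice of normal form, the three assertions are equivalent
    ∀ U : Set (Fin n → ℂ), AbelianLinear.IsOrbitRegion G u U →
      ∀ (P : GL (Fin n) ℂ) (η : Composition n), AbelianLinear.IsNormalForm G P η →
        ∀ m : ℕ, List.TFAE [
          AbelianLinear.IsRegularOfOrder m (AbelianLinear.orbit G u),
          ∀ v ∈ U, AbelianLinear.IsRegularOfOrder m (AbelianLinear.orbit G v),
          AbelianLinear.HasRealDim (closure (AbelianLinear.logOrbit G P η u)) m] := by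
  refine ⟨⟨_, AbelianLinear.isOrbitRegion_generators hG u⟩, AbelianLinear.exists_isNormalForm hG,
    fun U hU P η hP m => ?_⟩
  tfae_have 1 ↔ 3 := AbelianLinear.isRegularOfOrder_iff_hasRealDim hG hP u m
  tfae_have 2 → 1 := fun h => h u hU.mem
  tfae_have 1 → 2 := fun h v hv => by
    obtain ⟨T, hT⟩ := hU.isomorphic u hU.mem v hv
    exact hT ▸ h.image T
  tfae_finish
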